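/- Let $\mathbf F$ be an algebraically closed field of characteristic $p>3$, let $\Gamma$ be an abelian group, and let $(\cdot,\cdot):\Gamma\times\Gamma\to\mathbf F^\times$ be a bicharacter, i.e. $(\alpha,\beta)(\beta,\alpha)=1$, $(\alpha,\beta+\gamma)=(\alpha,\beta)(\alpha,\gamma)$ and $(\alpha+\beta,\gamma)=(\alpha,\gamma)(\beta,\gamma)$. Put $\Gamma^{\pm}=\{\gamma\in\Gamma : (\gamma,\gamma)=\pm1\}$. A Lie color algebra is a $\Gamma$-graded vector space $\mathfrak g=\bigoplus_{\alpha\in\Gamma}\mathfrak g_\alpha$ (of any dimension) with a bilinear bracket such that $[\mathfrak g_\alpha,\mathfrak g_\beta]\subseteq\mathfrak g_{\alpha+\beta}$, $[y,x]=-(\beta,\alpha)[x,y]$ and $(\gamma,\alpha)[x,[y,z]]+(\alpha,\beta)[y,[z,x]]+(\beta,\gamma)[z,[x,y]]=0$ for $x\in\mathfrak g_\alpha$, $y\in\mathfrak g_\beta$, $z\in\mathfrak g_\gamma$. Put $\mathfrak g^{\pm}=\bigoplus_{\gamma\in\Gamma^{\pm}}\mathfrak g_\gamma$. Let $\mathfrak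 g$ be restricted: for every $\gamma\in\Gamma^+$ there is given a map $x\mapsto x^{[p]}$, $\mathfrak g_\gamma\to\mathfrak g_{p\gamma}$, such that for $x,y\in\mathfrak g_\gamma$ and $r\in\mathbf F$ one has $(x+y)^{[p]}=x^{[p]}+y^{[p]}+\sum_{i=1}^{p-1}s_i(x,y)$, where $i\,s_i(x,y)$ is the coefficient of $t^{i-1}$ in $(\operatorname{ad}(tx+y))^{p-1}(x)\in\mathfrak g[t]$, $(rx)^{[p]}=r^px^{[p]}$, and $\operatorname{ad}x^{[p]}=(\operatorname{ad}x)^p$ on $\mathfrak g$. Let $U(\mathfrak g)$ be the quotient of the tensor algebra of $\mathfrak g$ by the two-sided ideal generated by all $x\otimes y-(\alpha,\beta)\,y\otimes x-[x,y]$ with $x\in\mathfrak g_\alpha$, $y\in\mathfrak g_\beta$. For a $\Gamma$-graded associative unital algebra $A$, a homomorphism $g:\mathfrak g\to A^-$ is a linear map with $g(\mathfrak g_\alpha)\subseteq A_\alpha$ and $g([x,y])=g(x)g(y)-(\alpha,\beta)g(y)g(x)$ for $x\in\mathfrak g_\alpha$, $y\in\mathfrak g_\beta$. For $\alpha\in\Gamma^+$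 such that $p\alpha\neq0$ has finite order $s=s_\alpha$, let $\mathscr F_\alpha$ be the set of classes $[\xi,c]$ of pairs $\xi\in\mathfrak g_\alpha$, $c\in\mathfrak g_\alpha^*$ with $c(\xi)=1$, under the equivalence relation: $(\xi,c)\sim(\eta,b)$ if $c=c(\eta)b$, $b=b(\xi)c$ and $c(\eta)^s=b(\xi)^s=1$. A (generalized) $p$-character $\chi=\{\chi_\alpha\}_{\alpha\in\Gamma^+}$ consists of $\chi_\alpha\in\mathfrak g_\alpha^*$ if $p\alpha=0$, $\chi_\alpha=0$ if $\alpha$ has infinite order, and $\chi_\alpha\in\mathscr F_\alpha\cup\{0\}$ if $p\alpha\ne0$ has finite order. (The zero form counts as an element of $\mathfrak g_\alpha^*$.) For a linear map $g:\mathfrak g\to A$ into an associative unital algebra, consider the conditions, for all $\alpha\in\Gamma^+$ and $x\in\mathfrak g_\alpha$, $$(*)\qquad\begin{cases} g(x)^p-g(x^{[p]})=\chi_\alpha(x)^p\cdot 1, & \text{if }\chi_\alpha\in\mathfrak g_\alpha^*,\\ (g(\xi)^p-g(\xi^{[p]}))^{s}=1,\quad g(x)^p-g(x^{[p]})=c(x)^p\,(g(\xi)^p-g(\xi^{[p]})),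 & \text{if }\chi_\alpha=[\xi,c]\in\mathscr F_\alpha,\end{cases}$$ which do not depend on the choice of the representatives $(\xi,c)$. Let $I_\chi$ be the two-sided ideal of $U(\mathfrak g)$ generated by the differences of the two sides of all the equations $(*)$ for the canonical map $g:\mathfrak g\to U(\mathfrak g)$, and let $\sigma:\mathfrak g\to U(\mathfrak g)/I_\chi$ be the canonical map. **Theorem.** (1) $U(\mathfrak g)/I_\chi$ with $\sigma$ is the $\chi$-reduced universal enveloping algebra of $\mathfrak g$. That is: $U(\mathfrak g)/I_\chi$ is a $\Gamma$-graded algebra, its component of degree $\gamma$ being spanned by the products $\sigma(x_1)\cdots\sigma(x_n)$, $n\ge0$, with $x_k\in\mathfrak g_{\alpha_k}$ and $\alpha_1+\dots+\alpha_n=\gamma$; $\sigma:\mathfrak g\to(U(\mathfrak g)/I_\chi)^-$ is a homomorphism satisfying $(*)$; and for every $\Gamma$-graded associative unital algebra $A$ and every homomorphism $g:\mathfrak g\to A^-$ satisfying $(*)$ there is a unique homomorphism $\tilde g:U(\mathfrak g)/I_\chi\to A$ of graded unital algebras with $\tilde g\circ\sigma=g$. (2) For every $\alpha$ with $\chi_\alpha\in\mathscr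 F_\alpha$ fix a representative $(\xi_\alpha,c_\alpha)$ of $\chi_\alpha$. Let $(e_i)_{i\in I}$ and $(f_j)_{j\in M}$ be totally ordered bases of $\mathfrak g^+$ and $\mathfrak g^-$ consisting of homogeneous elements, such that every $\xi_\alpha$ occurs among the $e_i$, and let $J=\{i\in I: e_i=\xi_\alpha\text{ for some }\alpha\text{ with }\chi_\alpha\in\mathscr F_\alpha\}$. Then the ordered products $$\sigma(f)^{\delta}\sigma(e)^{n}=\prod_{j\in M}\sigma(f_j)^{\delta_j}\prod_{i\in I}\sigma(e_i)^{n(i)},$$ where $\delta:M\to\{0,1\}$ and $n:I\to\mathbb N$ have finite support, $n(i)<p$ for $i\in I\setminus J$, and $n(i)<p\,s_\alpha$ for $i\in J$ with $e_i=\xi_\alpha$, form a basis of $U(\mathfrak g)/I_\chi$ (distinct pairs $(\delta,n)$ giving distinct basis elements). -/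

import Mathlib

noncomputable section

namespace ColorLie

/-- A bicharacter `Γ × Γ → Fˣ` with `(a,b)(b,a) = 1`. -/
structure Bicharacter (F Γ : Type*) [Field F] [AddCommGroup Γ] where
  toFun : Γ → Γ → Fˣ
  skew : ∀ a b, toFun a b * toFun b a = 1
  add_right : ∀ a b c, toFun a (b + c) = toFun a b * toFun a c
  add_left : ∀ a b c, toFun (a + b) c = toFun a c * toFun b c

namespace Bicharacter

variable {F Γ : Type*} [Field F] [AddCommGroup Γ]

/-- The value `(a,b)` as an element of `F`. -/
def val (ε : Bicharacter F Γ) (a b : Γ) : F := (ε.toFun a b : F)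

/-- `Γ⁺`, the set of all `γ` with `(γ,γ) = 1`. -/
abbrev Even (ε : Bicharacter F Γ) : Type _ := {γ : Γ // ε.val γ γ = 1}

/-- `Γ⁻`, the set of all `γ` with `(γ,γ) = -1`. -/
abbrev Odd (ε : Bicharacter F Γ) : Type _ := {γ : Γ // ε.val γ γ = -1}

end Bicharacter

/-- A Lie color algebra structure on the `F`-vector space `L`: a `Γ`-grading `L = ⨁ deg γ` and a
bilinear graded bracket satisfying color skew-symmetry and the color Jacobi identity. -/
structure LieColorAlgebra {F Γ : Type*} [Field F] [AddCommGroup Γ] [DecidableEq Γ]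
    (ε : Bicharacter F Γ) (L : Type*) [AddCommGroup L] [Module F L] where
  deg : Γ → Submodule F L
  isInternal : DirectSum.IsInternal deg
  bracket : L →ₗ[F] L →ₗ[F] L
  bracket_mem : ∀ (α β : Γ) (x y : L), x ∈ deg α → y ∈ deg β → bracket x y ∈ deg (α + β)
  skew : ∀ (α β : Γ) (x y : L), x ∈ deg α → y ∈ deg β →
    bracket y x = -(ε.val β α • bracket x y)
  jacobi : ∀ (α β γ : Γ) (x y z : L), x ∈ deg α → y ∈ deg β → z ∈ deg γ →
    ε.val γ α • bracket x (bracket y z) + ε.val α β • bracket y (bracket z x)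
      + ε.val β γ • bracket z (bracket x y) = 0

/-- A family of subspaces is a grading of the unital associative algebra `A`. -/
def IsGradedAlgebra {F Γ A : Type*} [Field F] [AddCommGroup Γ] [DecidableEq Γ] [Ring A]
    [Algebra F A] (𝒜 : Γ → Submodule F A) : Prop :=
  SetLike.GradedMonoid 𝒜 ∧ DirectSum.IsInternal 𝒜

/-- The ordered product `∏ z i ^ r i`, the factors being taken in increasing order of `i`. -/
def orderedProd {I A : Type*} [LinearOrder I] [Ring A] (z : I → A) (r : I →₀ ℕ) : A :=
  ((r.support.sort).map fun i => z i ^ r i).prod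

namespace LieColorAlgebra

variable {F Γ : Type*} [Field F] [AddCommGroup Γ] [DecidableEq Γ] {ε : Bicharacter F Γ}
  {L : Type*} [AddCommGroup L] [Module F L]

/-- `x` is homogeneous. -/
def IsHomogeneous (G : LieColorAlgebra ε L) (x : L) : Prop := ∃ γ, x ∈ G.deg γ

/-- The even part `L⁺`, the sum of the `L_γ` over `γ ∈ Γ⁺`. -/
def evenPart (G : LieColorAlgebra ε L) : Submodule F L := ⨆ γ : ε.Even, G.deg γ.1

/-- The odd part `L⁻`, the sum of the `L_γ` over `γ ∈ Γ⁻`. -/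
def oddPart (G : LieColorAlgebra ε L) : Submodule F L := ⨆ γ : ε.Odd, G.deg γ.1

/-- The operator `ad (t x + y)` on `L[t]`. -/
def adPoly (G : LieColorAlgebra ε L) (x y : L) (m : PolynomialModule F L) :
    PolynomialModule F L :=
  (Polynomial.X : Polynomial F) • PolynomialModule.map F (G.bracket x) m
    + PolynomialModule.map F (G.bracket y) m

/-- `s_i(x,y)`: `i • s_i(x,y)` is the coefficient of `t ^ (i-1)` in
`(ad (t x + y)) ^ (p-1) (x)`, an element of `L[t]`. Used for `1 ≤ i ≤ p - 1`. -/
def jacobsonTerm (G : LieColorAlgebra ε L) (p i : ℕ) (x y : L) : L :=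
  (i : F)⁻¹ • ((G.adPoly x y)^[p - 1] (PolynomialModule.single F 0 x)).coeff (i - 1)

/-- A restricted structure: `p`-maps `L_γ → L_{pγ}` for `γ ∈ Γ⁺`. -/
structure Restricted (G : LieColorAlgebra ε L) (p : ℕ) where
  pmap : (γ : ε.Even) → G.deg γ.1 → G.deg (p • γ.1)
  pmap_add : ∀ (γ : ε.Even) (x y : G.deg γ.1),
    (pmap γ (x + y) : L) = pmap γ x + pmap γ y
      + ∑ i ∈ Finset.Icc 1 (p - 1), G.jacobsonTerm p i x y
  pmap_smul : ∀ (γ : ε.Even) (r : F) (x : G.deg γ.1),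
    (pmap γ (r • x) : L) = r ^ p • (pmap γ x : L)
  ad_pmap : ∀ (γ : ε.Even) (x : G.deg γ.1) (y : L),
    G.bracket (pmap γ x) y = (G.bracket (x : L))^[p] y

/-- A homomorphism of Lie color algebras `L → A⁻`, where `A` is a graded associative algebra and
`A⁻` is `A` with the bracket `[a,b] = a b - (α,β) b a` for `a ∈ A_α`, `b ∈ A_β`. -/
def IsColorHom (G : LieColorAlgebra ε L) {A : Type*} [Ring A] [Algebra F A]
    (𝒜 : Γ → Submodule F A) (g : L →ₗ[F] A) : Prop :=
  (∀ (α : Γ) (x : L), x ∈ G.deg α → g x ∈ 𝒜 α) ∧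
  ∀ (α β : Γ) (x y : L), x ∈ G.deg α → y ∈ G.deg β →
    g (G.bracket x y) = g x * g y - ε.val α β • (g y * g x)

/-- The ideal of the tensor algebra generated by `x ⊗ y - (α,β) y ⊗ x - [x,y]` for homogeneous
`x`, `y` of degrees `α`, `β`. -/
def envelopingIdeal (G : LieColorAlgebra ε L) : TwoSidedIdeal (TensorAlgebra F L) :=
  TwoSidedIdeal.span {t | ∃ (α β : Γ) (x y : L), x ∈ G.deg α ∧ y ∈ G.deg β ∧
    t = TensorAlgebra.ι F x * TensorAlgebra.ι F y
      - ε.val α β • (TensorAlgebra.ι F y * TensorAlgebra.ι F x)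
      - TensorAlgebra.ι F (G.bracket x y)}

/-- The universal enveloping algebra `U(L)`. -/
abbrev Enveloping (G : LieColorAlgebra ε L) : Type _ :=
  TensorAlgebra F L ⧸ G.envelopingIdeal.asIdeal

/-- The canonical map `L → U(L)`. -/
def envι (G : LieColorAlgebra ε L) : L →ₗ[F] G.Enveloping :=
  (Ideal.Quotient.mkₐ F G.envelopingIdeal.asIdeal).toLinearMap ∘ₗ TensorAlgebra.ι F

/-- For a linear map `φ : L → B`, the span of all products `φ x₁ ⋯ φ xₙ` (`n ≥ 0`) with `xᵢ`
homogeneous and degrees adding up to `γ`. For the canonical map into a quotient of `U(L)` by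
homogeneous relations this is the component of degree `γ` of the grading inherited from `L`. -/
def inducedGrading (G : LieColorAlgebra ε L) {B : Type*} [Ring B] [Algebra F B]
    (φ : L →ₗ[F] B) (γ : Γ) : Submodule F B :=
  Submodule.span F {b | ∃ l : List (Σ α : Γ, G.deg α),
    (l.map fun x => x.1).sum = γ ∧ b = (l.map fun x => φ (x.2 : L)).prod}

/-- Pairs `(ξ, c)` with `ξ ∈ L_α`, `c` a linear form on `L_α` and `c ξ = 1`. -/
structure DistPair (G : LieColorAlgebra ε L) (α : Γ) where
  ξ : G.deg α
  c : Module.Dual F (G.deg α)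
  c_ξ : c ξ = 1

/-- `(ξ,c) ∼ (η,b)` if `c = c(η) b`, `b = b(ξ) c` and `c(η) ^ s = b(ξ) ^ s = 1`, where `s` is the
order of `pα`. -/
def distSetoid (G : LieColorAlgebra ε L) (p : ℕ) (α : Γ) : Setoid (G.DistPair α) where
  r P Q := P.c = P.c Q.ξ • Q.c ∧ Q.c = Q.c P.ξ • P.c ∧
    P.c Q.ξ ^ addOrderOf (p • α) = 1 ∧ Q.c P.ξ ^ addOrderOf (p • α) = 1
  iseqv := by
    refine ⟨fun P => by simp [P.c_ξ], fun h => ⟨h.2.1, h.1, h.2.2.2, h.2.2.1⟩, ?_⟩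
    rintro P Q R ⟨h1, h2, h3, h4⟩ ⟨k1, k2, k3, k4⟩
    have e1 : P.c R.ξ = P.c Q.ξ * Q.c R.ξ := by
      conv_lhs => rw [h1]
      simp
    have e2 : R.c P.ξ = R.c Q.ξ * Q.c P.ξ := by
      conv_lhs => rw [k2]
      simp
    refine ⟨?_, ?_, ?_, ?_⟩
    · rw [e1, mul_smul, ← k1, ← h1]
    · rw [e2, mul_smul, ← h2, ← k2]
    · rw [e1, mul_pow, h3, k3, one_mul]
    · rw [e2, mul_pow, h4, k4, one_mul]

/-- The set `𝓕_α` of equivalence classes `[ξ, c]`. -/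
abbrev DistClass (G : LieColorAlgebra ε L) (p : ℕ) (α : Γ) : Type _ :=
  Quotient (G.distSetoid p α)

/-- The class `[ξ, c]`. -/
def DistPair.mk' {G : LieColorAlgebra ε L} (p : ℕ) {α : Γ} (P : G.DistPair α) :
    G.DistClass p α :=
  Quotient.mk (G.distSetoid p α) P

/-- A (generalized) `p`-character: for each `α ∈ Γ⁺` either a linear form on `L_α` (`Sum.inl`) or
a class in `𝓕_α` (`Sum.inr`), subject to the three conditions below
(`addOrderOf α = 0` means that `α` has infinite order). -/
structure PCharacter (G : LieColorAlgebra ε L) (p : ℕ) where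
  toFun : (α : ε.Even) → Module.Dual F (G.deg α.1) ⊕ G.DistClass p α.1
  of_eq_zero : ∀ α : ε.Even, p • α.1 = 0 → ∃ l, toFun α = Sum.inl l
  of_infinite : ∀ α : ε.Even, addOrderOf α.1 = 0 → toFun α = Sum.inl 0
  of_finite : ∀ α : ε.Even, p • α.1 ≠ 0 → addOrderOf (p • α.1) ≠ 0 →
    toFun α = Sum.inl 0 ∨ ∃ q, toFun α = Sum.inr q

namespace PCharacter

variable {G : LieColorAlgebra ε L} {p : ℕ}

/-- The relations imposed by `χ` on a linear map `g : L → A`: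
`g(x)^p - g(x^[p]) = χ_α(x)^p` if `χ_α` is a linear form, and
`(g(ξ)^p - g(ξ^[p]))^s = 1`, `g(x)^p - g(x^[p]) = c(x)^p (g(ξ)^p - g(ξ^[p]))`
if `χ_α = [ξ, c]` and `s` is the order of `pα`. -/
def Holds (χ : G.PCharacter p) (R : G.Restricted p) {A : Type*} [Ring A] [Algebra F A]
    (g : L →ₗ[F] A) : Prop :=
  (∀ (α : ε.Even) (l : Module.Dual F (G.deg α.1)), χ.toFun α = Sum.inl l →
    ∀ x : G.deg α.1, g x ^ p - g (R.pmap α x) = algebraMap F A (l x ^ p)) ∧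
  ∀ (α : ε.Even) (P : G.DistPair α.1), χ.toFun α = Sum.inr (P.mk' p) →
    (g P.ξ ^ p - g (R.pmap α P.ξ)) ^ addOrderOf (p • α.1) = 1 ∧
    ∀ x : G.deg α.1, g x ^ p - g (R.pmap α x) =
      (P.c x) ^ p • (g P.ξ ^ p - g (R.pmap α P.ξ))

/-- The two-sided ideal `I_χ` of `U(L)`. -/
def ideal (χ : G.PCharacter p) (R : G.Restricted p) : TwoSidedIdeal G.Enveloping :=
  TwoSidedIdeal.span
    ({u | ∃ (α : ε.Even) (l : Module.Dual F (G.deg α.1)) (x : G.deg α.1),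
        χ.toFun α = Sum.inl l ∧
        u = G.envι x ^ p - G.envι (R.pmap α x) - algebraMap F G.Enveloping (l x ^ p)} ∪
     {u | ∃ (α : ε.Even) (P : G.DistPair α.1), χ.toFun α = Sum.inr (P.mk' p) ∧
        u = (G.envι P.ξ ^ p - G.envι (R.pmap α P.ξ)) ^ addOrderOf (p • α.1) - 1} ∪
     {u | ∃ (α : ε.Even) (P : G.DistPair α.1) (x : G.deg α.1),
        χ.toFun α = Sum.inr (P.mk' p) ∧
        u = (G.envι x ^ p - G.envι (R.pmap α x))
          - (P.c x) ^ p • (G.envι P.ξ ^ p - G.envι (R.pmap α P.ξ))})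

/-- The quotient `U(L) / I_χ`. -/
abbrev Reduced (χ : G.PCharacter p) (R : G.Restricted p) : Type _ :=
  G.Enveloping ⧸ (χ.ideal R).asIdeal

/-- The canonical map `σ : L → U(L) / I_χ`. -/
def σ (χ : G.PCharacter p) (R : G.Restricted p) : L →ₗ[F] χ.Reduced R :=
  (Ideal.Quotient.mkₐ F (χ.ideal R).asIdeal).toLinearMap ∘ₗ G.envι

/-- The algebra `B` with the subspaces `ℬ γ` and the map `σ : L → B` is a `χ`-reduced universal
enveloping algebra of `L`: `ℬ` is a grading, `σ` is a homomorphism of Lie color algebras `L → B⁻`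
satisfying the relations of `χ`, and every such homomorphism into a graded unital associative
algebra `A` factors uniquely through a homomorphism of graded unital algebras. -/
def IsReducedEnveloping.{w, a, b, c, d} {F : Type a} {Γ : Type b} [Field F] [AddCommGroup Γ]
    [DecidableEq Γ] {ε : Bicharacter F Γ} {L : Type c} [AddCommGroup L] [Module F L]
    {G : LieColorAlgebra ε L} {p : ℕ} (χ : G.PCharacter p) (R : G.Restricted p)
    {B : Type d} [Ring B] [Algebra F B] (ℬ : Γ → Submodule F B) (σ : L →ₗ[F] B) : Prop :=
  IsGradedAlgebra ℬ ∧ G.IsColorHom ℬ σ ∧ χ.Holds R σ ∧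
  ∀ (A : Type w) [Ring A] [Algebra F A] (𝒜 : Γ → Submodule F A), IsGradedAlgebra 𝒜 →
    ∀ g : L →ₗ[F] A, G.IsColorHom 𝒜 g → χ.Holds R g →
      ∃! h : B →ₐ[F] A, (∀ (γ : Γ) (b : B), b ∈ ℬ γ → h b ∈ 𝒜 γ) ∧ ∀ x : L, h (σ x) = g x

/-- The set of those `α ∈ Γ⁺` for which `χ_α` is a class `[ξ, c]`. -/
abbrev ClassDegree (χ : G.PCharacter p) : Type _ := {α : ε.Even // ∃ q, χ.toFun α = Sum.inr q}

end PCharacter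

end LieColorAlgebra

end ColorLie

end

universe w

/-! For `x` in an even component of degree `α` put `z(x) = x^p - x^[p]` in `U(L)`. Jacobson's
formula for `(x+y)^p` makes `z` additive, hence `p`-semilinear, on the component; the identity `ad
x^[p] = (ad x)^p` makes `z(x)` commute with every homogeneous element up to a value of the
bicharacter. By semilinearity `I_χ` is generated by one relator `w_x` for each basis element `x`:
`z(x) - l(x)^p` if `χ_α` is a linear form `l`, `z(ξ)^s - 1` for a distinguished `x = ξ`, `z(x) -
c(x)^p z(ξ)` for the other `x` in the degree of a class `[ξ,c]`, and `0` for odd `x`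
(`exists_relator`).

The basis comes from division with remainder in the Poincaré–Birkhoff–Witt basis of `U(L)`.
Distinguished letters get weight 2 and all others weight 3. A bracket is a combination of letters,
of weight at most 3, whereas two letters weigh at least 4; so letters commute up to scalars and
lower weight. For `x` not odd, `w_x` has the leading term `x^q` with `q = p` or `q = p s`: the
competitor `ξ^p` in `z(x) - c(x)^p z(ξ)` weighs `2p < 3p`. Hence the products `x^r w^a` with `r < q`
are triangular over the PBW basis. As the `w_x` commute up to scalars with the letters and with each
other, the products with `a ≠ 0` span exactly `I_χ`, and the remaining ones survive as a basis
(`exists_basis_quotient`).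

The PBW theorem (`exists_pbw_basis`) is proved by a diamond-lemma argument in the tensor algebra:
words are ranked by length and inversions, and two relators with the same leading word differ by
relators of smaller rank (`confluence`). For overlapping leading words this is the Jacobi identity
(`relator_overlap`).

The universal property is formal. The sum of the graded pieces is direct because the relations of
`χ` are homogeneous, so that `x ↦ x ⊗ [α]` extends to a coaction of the group algebra of `Γ` that
separates degrees. -/

noncomputable section

namespace ColorLie

/-! ### Linear algebra: triangular families, and quotients by the span of part of a basis -/

section Triangular

variable {F V : Type*} [Field F] [AddCommGroup V] [Module F V]

/-- A family that is triangular with respect to a basis, for a rank function with values in a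
well-founded linear order, is a basis. -/
theorem exists_basis_of_triangular {ι P : Type*} [LinearOrder P] [WellFoundedLT P]
    (B : Module.Basis ι F V) (μ : ι → P) (v : ι → V) (c : ι → F) (hc : ∀ i, c i ≠ 0)
    (h : ∀ i, v i - c i • B i ∈ Submodule.span F (B '' {j | μ j < μ i})) :
    ∃ B' : Module.Basis ι F V, ∀ i, B' i = v i := by
  have hrepr : ∀ i j, j ≠ i → ¬ μ j < μ i → B.repr (v i) j = 0 := by
    intro i j hji hlt
    have h1 := B.mem_span_image.1 (h i)
    have h2 : B.repr (v i - c i • B i) j = 0 := by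
      by_contra hne
      exact hlt (h1 (Finsupp.mem_support_iff.2 hne))
    simpa [Finsupp.single_apply, hji.symm] using h2
  have hdiag : ∀ i, B.repr (v i) i = c i := by
    intro i
    have h1 := B.mem_span_image.1 (h i)
    have h2 : B.repr (v i - c i • B i) i = 0 := by
      by_contra hne
      exact lt_irrefl _ (h1 (Finsupp.mem_support_iff.2 hne))
    simpa [sub_eq_zero] using h2
  have hli : LinearIndependent F v := by
    rw [linearIndependent_iff]
    intro a ha
    by_contra hne
    -- At an index of maximal rank in the support only the diagonal term contributes to the
    -- coordinate; other indices of the same rank contribute zero, because the error terms have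
    -- strictly smaller rank.
    obtain ⟨i, hi, hmax⟩ :=
      a.support.exists_max_image μ (Finsupp.support_nonempty_iff.2 hne)
    have h1 : B.repr (Finsupp.linearCombination F v a) i = a i * c i := by
      rw [Finsupp.linearCombination_apply, Finsupp.sum, map_sum, Finset.sum_apply',
        Finset.sum_eq_single i]
      · simp [hdiag]
      · intro j hj hji
        simp [hrepr j i hji.symm (not_lt.2 (hmax j hj))]
      · intro hi'
        exact absurd hi hi'
    rw [ha] at h1
    exact mul_ne_zero (Finsupp.mem_support_iff.1 hi) (hc i) (by simpa using h1.symm)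
  have hB : ∀ (p : P) (i : ι), μ i = p → B i ∈ Submodule.span F (Set.range v) := by
    intro p
    induction p using WellFoundedLT.induction with
    | ind p ih =>
      rintro i rfl
      have h1 : v i - c i • B i ∈ Submodule.span F (Set.range v) := by
        refine Submodule.span_le.2 ?_ (h i)
        rintro _ ⟨j, hj, rfl⟩
        exact ih (μ j) hj j rfl
      have h2 : c i • B i ∈ Submodule.span F (Set.range v) := by
        have := Submodule.sub_mem (Submodule.span F (Set.range v)) (Submodule.subset_span ⟨i, rfl⟩) h1
        simpa using this
      exact (Submodule.smul_mem_iff _ (hc i)).1 h2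
  refine ⟨Module.Basis.mk hli ?_, fun i => Module.Basis.mk_apply _ _ _⟩
  rw [← B.span_eq]
  refine Submodule.span_le.2 ?_
  rintro _ ⟨i, rfl⟩
  exact hB _ i rfl

/-- If the kernel of a surjection is spanned by a part of a basis, the other basis elements map to
a basis. -/
theorem exists_basis_of_ker_eq_span {ι V' : Type*} [AddCommGroup V'] [Module F V']
    (B : Module.Basis ι F V) (S : Set ι) (φ : V →ₗ[F] V') (hφ : Function.Surjective φ)
    (hker : LinearMap.ker φ = Submodule.span F (B '' S)) :
    ∃ B' : Module.Basis {i // i ∉ S} F V', ∀ i, B' i = φ (B i.1) := by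
  have hli : LinearIndependent F (fun i : {i // i ∉ S} => φ (B i.1)) := by
    refine LinearIndependent.map (f := φ) (B.linearIndependent.comp _ Subtype.val_injective) ?_
    rw [hker]
    have h1 : Set.range (B ∘ (Subtype.val : {i // i ∉ S} → ι)) = B '' Sᶜ := by
      ext x
      simp
    rw [h1]
    exact B.linearIndependent.disjoint_span_image disjoint_compl_left
  refine ⟨Module.Basis.mk hli ?_, fun i => Module.Basis.mk_apply _ _ _⟩
  rintro y -
  obtain ⟨x, rfl⟩ := hφ y
  have hx : x ∈ Submodule.span F (Set.range B) := by simp [B.span_eq]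
  induction hx using Submodule.span_induction with
  | mem x hx =>
    obtain ⟨i, rfl⟩ := hx
    by_cases hi : i ∈ S
    · have : B i ∈ LinearMap.ker φ := by
        rw [hker]
        exact Submodule.subset_span ⟨i, hi, rfl⟩
      rw [LinearMap.mem_ker.1 this]
      exact Submodule.zero_mem _
    · exact Submodule.subset_span ⟨⟨i, hi⟩, rfl⟩
  | zero => simp
  | add x y _ _ hx hy => rw [map_add]; exact Submodule.add_mem _ hx hy
  | smul a x _ hx => rw [map_smul]; exact Submodule.smul_mem _ _ hx

end Triangular

/-! ### Words, their contents and their sorted rearrangements -/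

section Words

variable {X A : Type*} [Ring A]

/-- The product of the letters of a word. -/
def wordProd (u : X → A) (l : List X) : A := (l.map u).prod

@[simp] theorem wordProd_nil (u : X → A) : wordProd u [] = 1 := rfl

@[simp] theorem wordProd_cons (u : X → A) (x : X) (l : List X) :
    wordProd u (x :: l) = u x * wordProd u l := by
  simp [wordProd]

@[simp] theorem wordProd_append (u : X → A) (l m : List X) :
    wordProd u (l ++ m) = wordProd u l * wordProd u m := by
  simp [wordProd]

variable [LinearOrder X]

/-- The weakly increasing word with prescribed multiplicities. -/
def sortedWord (n : X →₀ ℕ) : List X := n.support.sort.flatMap fun x => List.replicate (n x) x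

theorem orderedProd_eq_wordProd (u : X → A) (n : X →₀ ℕ) :
    orderedProd u n = wordProd u (sortedWord n) := by
  unfold orderedProd sortedWord wordProd
  induction n.support.sort with
  | nil => simp
  | cons x l ih => simp [ih]

theorem count_sortedWord (n : X →₀ ℕ) (x : X) : (sortedWord n).count x = n x := by
  unfold sortedWord
  rw [List.count_flatMap]
  have h1 : ∀ l : List X, l.Nodup →
      (l.map (List.count x ∘ fun y => List.replicate (n y) y)).sum
        = if x ∈ l then n x else 0 := by
    intro l hl
    induction l with
    | nil => simp
    | cons y l ih =>
      rw [List.nodup_cons] at hl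
      rw [List.map_cons, List.sum_cons, ih hl.2]
      by_cases hxy : y = x
      · subst hxy
        simp [hl.1]
      · have : x ≠ y := fun h => hxy h.symm
        simp [List.count_replicate, hxy, this]
  rw [h1 _ (Finset.sort_nodup _ _)]
  simp only [Finset.mem_sort, Finsupp.mem_support_iff]
  split_ifs with h
  · rfl
  · exact (not_not.1 h).symm

theorem pairwise_sortedWord (n : X →₀ ℕ) : (sortedWord n).Pairwise (· ≤ ·) := by
  unfold sortedWord
  rw [List.pairwise_flatMap]
  refine ⟨fun x _ => List.pairwise_replicate.2 (Or.inr le_rfl), ?_⟩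
  refine (Finset.pairwise_sort n.support (· ≤ ·)).imp ?_
  intro a b hab x hx y hy
  rw [(List.mem_replicate.1 hx).2, (List.mem_replicate.1 hy).2]
  exact hab

/-- The multiplicities of the letters of a word. -/
def content (l : List X) : X →₀ ℕ := Multiset.toFinsupp (l : Multiset X)

@[simp] theorem content_apply (l : List X) (x : X) : content l x = l.count x := by
  simp [content]

theorem content_cons (x : X) (l : List X) : content (x :: l) = Finsupp.single x 1 + content l := by
  ext y
  simp [List.count_cons, Finsupp.single_apply, add_comm]

theorem content_append (l m : List X) : content (l ++ m) = content l + content m := by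
  ext y
  simp

@[simp] theorem content_sortedWord (n : X →₀ ℕ) : content (sortedWord n) = n := by
  ext x
  rw [content_apply, count_sortedWord]

theorem perm_sortedWord_content (l : List X) : l.Perm (sortedWord (content l)) := by
  rw [List.perm_iff_count]
  intro x
  rw [count_sortedWord, content_apply]

theorem sortedWord_content {l : List X} (hl : l.Pairwise (· ≤ ·)) :
    sortedWord (content l) = l :=
  ((perm_sortedWord_content l).symm).eq_of_pairwise
    (fun _ _ _ _ h1 h2 => le_antisymm h1 h2) (pairwise_sortedWord _) hl

theorem sortedWord_single (x : X) (k : ℕ) :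
    sortedWord (Finsupp.single x k) = List.replicate k x := by
  have h : content (List.replicate k x) = Finsupp.single x k := by
    ext y
    simp [List.count_replicate, Finsupp.single_apply]
  rw [← h]
  exact sortedWord_content (List.pairwise_replicate.2 (Or.inr le_rfl))

@[simp] theorem orderedProd_single (u : X → A) (x : X) (k : ℕ) :
    orderedProd u (Finsupp.single x k) = u x ^ k := by
  rw [orderedProd_eq_wordProd, sortedWord_single]
  simp [wordProd]

@[simp] theorem orderedProd_zero (u : X → A) : orderedProd u 0 = 1 := by
  simp [orderedProd]

end Words

/-! ### Weight filtration and leading exponents -/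

section Weight

variable {F A X : Type*} [Field F] [Ring A] [Algebra F A]

variable (F) in
/-- The span of all words in the letters `u x` of weight less than `m`. -/
def lowerWeight (u : X → A) (wt : X → ℕ) (m : ℕ) : Submodule F A :=
  Submodule.span F {a | ∃ l : List X, (l.map wt).sum < m ∧ a = wordProd u l}

variable {u : X → A} {wt : X → ℕ}

theorem wordProd_mem_lowerWeight {l : List X} {m : ℕ} (h : (l.map wt).sum < m) :
    wordProd u l ∈ lowerWeight F u wt m :=
  Submodule.subset_span ⟨l, h, rfl⟩

theorem lowerWeight_mono {m m' : ℕ} (h : m ≤ m') :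
    lowerWeight F u wt m ≤ lowerWeight F u wt m' :=
  Submodule.span_mono fun _ ⟨l, hl, e⟩ => ⟨l, hl.trans_le h, e⟩

theorem wordProd_mul_mem_lowerWeight {a : A} {m : ℕ} (l : List X)
    (ha : a ∈ lowerWeight F u wt m) :
    wordProd u l * a ∈ lowerWeight F u wt ((l.map wt).sum + m) := by
  induction ha using Submodule.span_induction with
  | mem a ha =>
    obtain ⟨l', hl', rfl⟩ := ha
    rw [← wordProd_append]
    exact wordProd_mem_lowerWeight (by simpa using hl')
  | zero => simp
  | add a b _ _ ha hb => rw [mul_add]; exact Submodule.add_mem _ ha hb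
  | smul c a _ ha => rw [mul_smul_comm]; exact Submodule.smul_mem _ _ ha

theorem mul_wordProd_mem_lowerWeight {a : A} {m : ℕ} (l : List X)
    (ha : a ∈ lowerWeight F u wt m) :
    a * wordProd u l ∈ lowerWeight F u wt (m + (l.map wt).sum) := by
  induction ha using Submodule.span_induction with
  | mem a ha =>
    obtain ⟨l', hl', rfl⟩ := ha
    rw [← wordProd_append]
    exact wordProd_mem_lowerWeight (by simpa using hl')
  | zero => simp
  | add a b _ _ ha hb => rw [add_mul]; exact Submodule.add_mem _ ha hb
  | smul c a _ ha => rw [smul_mul_assoc]; exact Submodule.smul_mem _ _ ha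

theorem mul_mem_lowerWeight {a b : A} {m m' : ℕ} (ha : a ∈ lowerWeight F u wt m)
    (hb : b ∈ lowerWeight F u wt m') : a * b ∈ lowerWeight F u wt (m + m') := by
  induction ha using Submodule.span_induction with
  | mem a ha =>
    obtain ⟨l, hl, rfl⟩ := ha
    exact lowerWeight_mono (by omega) (wordProd_mul_mem_lowerWeight l hb)
  | zero => simp
  | add a b _ _ ha hb => rw [add_mul]; exact Submodule.add_mem _ ha hb
  | smul c a _ ha => rw [smul_mul_assoc]; exact Submodule.smul_mem _ _ ha

/-- A permutation is a chain of adjacent transpositions. Each costs a nonzero scalar and an error of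
lower weight, and the errors stay below the same bound because all the words involved have equal
weight. -/
theorem wordProd_sub_smul_of_perm
    (hcomm : ∀ x y, ∃ c : F, c ≠ 0 ∧
      u x * u y - c • (u y * u x) ∈ lowerWeight F u wt (wt x + wt y))
    {l m : List X} (h : l.Perm m) :
    ∃ c : F, c ≠ 0 ∧ wordProd u l - c • wordProd u m ∈ lowerWeight F u wt (l.map wt).sum := by
  induction h with
  | nil => exact ⟨1, one_ne_zero, by simp⟩
  | cons x _ ih =>
    obtain ⟨c, hc, h⟩ := ih
    refine ⟨c, hc, ?_⟩
    have := wordProd_mul_mem_lowerWeight [x] h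
    simpa [mul_sub] using this
  | swap x y l =>
    obtain ⟨c, hc, h⟩ := hcomm y x
    refine ⟨c, hc, ?_⟩
    have := mul_wordProd_mem_lowerWeight l h
    simpa [sub_mul, mul_assoc, add_assoc] using this
  | @trans l₁ l₂ l₃ h12 _ ih1 ih2 =>
    obtain ⟨c, hc, h⟩ := ih1
    obtain ⟨d, hd, h'⟩ := ih2
    refine ⟨c * d, mul_ne_zero hc hd, ?_⟩
    rw [← (h12.map wt).sum_eq] at h'
    have e : wordProd u l₁ - (c * d) • wordProd u l₃
        = (wordProd u l₁ - c • wordProd u l₂) + c • (wordProd u l₂ - d • wordProd u l₃) := by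
      rw [smul_sub, mul_smul]
      abel
    rw [e]
    exact Submodule.add_mem _ h (Submodule.smul_mem _ _ h')

/-- The exponent `x ↦ a x * q x`. -/
def dilate (q : X → ℕ) (a : X →₀ ℕ) : X →₀ ℕ :=
  Finsupp.onFinset a.support (fun x => a x * q x) fun _ hx =>
    Finsupp.mem_support_iff.2 (left_ne_zero_of_mul hx)

/-- The exponent `x ↦ n x % q x`. -/
def residue (q : X → ℕ) (n : X →₀ ℕ) : X →₀ ℕ :=
  Finsupp.onFinset n.support (fun x => n x % q x) fun _ hx =>
    Finsupp.mem_support_iff.2 fun h => hx (by simp [h])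

/-- The exponent `x ↦ n x / q x`. -/
def quotient (q : X → ℕ) (n : X →₀ ℕ) : X →₀ ℕ :=
  Finsupp.onFinset n.support (fun x => n x / q x) fun _ hx =>
    Finsupp.mem_support_iff.2 fun h => hx (by simp [h])

@[simp] theorem dilate_apply (q : X → ℕ) (a : X →₀ ℕ) (x : X) : dilate q a x = a x * q x := rfl
@[simp] theorem residue_apply (q : X → ℕ) (n : X →₀ ℕ) (x : X) : residue q n x = n x % q x := rfl
@[simp] theorem quotient_apply (q : X → ℕ) (n : X →₀ ℕ) (x : X) :
    quotient q n x = n x / q x := rfl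

theorem residue_add_dilate_quotient (q : X → ℕ) (n : X →₀ ℕ) :
    residue q n + dilate q (quotient q n) = n := by
  ext x
  simp [Nat.mod_add_div']

variable [LinearOrder X]

theorem weight_content (wt : X → ℕ) (l : List X) :
    Finsupp.weight wt (content l) = (l.map wt).sum := by
  induction l with
  | nil =>
    have : content ([] : List X) = 0 := by ext; simp
    simp [this]
  | cons x l ih => rw [content_cons, map_add, ih, Finsupp.weight_single]; simp

theorem sum_map_sortedWord (wt : X → ℕ) (n : X →₀ ℕ) :
    ((sortedWord n).map wt).sum = Finsupp.weight wt n := by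
  rw [← weight_content, content_sortedWord]

variable (F u wt) in
/-- `a` is a nonzero multiple of the ordered monomial with exponent `n`, up to terms of lower
weight. -/
def HasLead (a : A) (n : X →₀ ℕ) : Prop :=
  ∃ c : F, c ≠ 0 ∧ a - c • orderedProd u n ∈ lowerWeight F u wt (Finsupp.weight wt n)

theorem hasLead_wordProd
    (hcomm : ∀ x y, ∃ c : F, c ≠ 0 ∧
      u x * u y - c • (u y * u x) ∈ lowerWeight F u wt (wt x + wt y)) (l : List X) :
    HasLead F u wt (wordProd u l) (content l) := by
  obtain ⟨c, hc, h⟩ := wordProd_sub_smul_of_perm hcomm (perm_sortedWord_content l)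
  refine ⟨c, hc, ?_⟩
  rwa [orderedProd_eq_wordProd, weight_content]

/-- Leading exponents add: each product involving an error term has lower weight than `n + m`, and
the product of the two ordered monomials is sorted at the cost of a nonzero scalar. -/
theorem HasLead.mul
    (hcomm : ∀ x y, ∃ c : F, c ≠ 0 ∧
      u x * u y - c • (u y * u x) ∈ lowerWeight F u wt (wt x + wt y))
    {a b : A} {n m : X →₀ ℕ} (ha : HasLead F u wt a n) (hb : HasLead F u wt b m) :
    HasLead F u wt (a * b) (n + m) := by
  obtain ⟨c, hc, ha⟩ := ha
  obtain ⟨d, hd, hb⟩ := hb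
  obtain ⟨k, hk, h⟩ := hasLead_wordProd hcomm (sortedWord n ++ sortedWord m)
  rw [content_append, content_sortedWord, content_sortedWord, wordProd_append,
    ← orderedProd_eq_wordProd, ← orderedProd_eq_wordProd] at h
  refine ⟨c * d * k, mul_ne_zero (mul_ne_zero hc hd) hk, ?_⟩
  rw [map_add] at h ⊢
  have h1 := mul_mem_lowerWeight ha hb
  have h2 := mul_wordProd_mem_lowerWeight (sortedWord m) ha
  have h3 := wordProd_mul_mem_lowerWeight (sortedWord n) hb
  rw [← orderedProd_eq_wordProd, sum_map_sortedWord] at h2 h3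
  have e : a * b - (c * d * k) • orderedProd u (n + m)
      = (a - c • orderedProd u n) * (b - d • orderedProd u m)
        + d • ((a - c • orderedProd u n) * orderedProd u m)
        + c • (orderedProd u n * (b - d • orderedProd u m))
        + (c * d) • (orderedProd u n * orderedProd u m - k • orderedProd u (n + m)) := by
    simp only [mul_sub, sub_mul, smul_sub, smul_mul_assoc, mul_smul_comm, smul_smul]
    rw [mul_comm d c]
    abel
  rw [e]
  exact Submodule.add_mem _ (Submodule.add_mem _ (Submodule.add_mem _ h1
    (Submodule.smul_mem _ _ h2)) (Submodule.smul_mem _ _ h3)) (Submodule.smul_mem _ _ h)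

theorem HasLead.one : HasLead F u wt 1 0 := ⟨1, one_ne_zero, by simp⟩

theorem HasLead.pow
    (hcomm : ∀ x y, ∃ c : F, c ≠ 0 ∧
      u x * u y - c • (u y * u x) ∈ lowerWeight F u wt (wt x + wt y))
    {a : A} {n : X →₀ ℕ} (ha : HasLead F u wt a n) (k : ℕ) :
    HasLead F u wt (a ^ k) (k • n) := by
  induction k with
  | zero => simpa using HasLead.one
  | succ k ih => rw [pow_succ, succ_nsmul]; exact ih.mul hcomm ha

theorem HasLead.add_lower {a b : A} {n : X →₀ ℕ} (ha : HasLead F u wt a n)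
    (hb : b ∈ lowerWeight F u wt (Finsupp.weight wt n)) : HasLead F u wt (a + b) n := by
  obtain ⟨c, hc, ha⟩ := ha
  refine ⟨c, hc, ?_⟩
  have e : a + b - c • orderedProd u n = (a - c • orderedProd u n) + b := by abel
  rw [e]
  exact Submodule.add_mem _ ha hb

theorem HasLead.sub_lower {a b : A} {n : X →₀ ℕ} (ha : HasLead F u wt a n)
    (hb : b ∈ lowerWeight F u wt (Finsupp.weight wt n)) : HasLead F u wt (a - b) n := by
  rw [sub_eq_add_neg]
  exact ha.add_lower (Submodule.neg_mem _ hb)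

theorem HasLead.orderedProd
    (hcomm : ∀ x y, ∃ c : F, c ≠ 0 ∧
      u x * u y - c • (u y * u x) ∈ lowerWeight F u wt (wt x + wt y))
    {w : X → A} {q : X → ℕ} {a : X →₀ ℕ}
    (hw : ∀ x, a x ≠ 0 → HasLead F u wt (w x) (Finsupp.single x (q x))) :
    HasLead F u wt (ColorLie.orderedProd w a) (dilate q a) := by
  have h1 : ∀ l : List X, (∀ x ∈ l, a x ≠ 0) →
      HasLead F u wt (l.map fun x => w x ^ a x).prod
        (l.map fun x => a x • Finsupp.single x (q x)).sum := by
    intro l hl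
    induction l with
    | nil => simpa using HasLead.one
    | cons x l ih =>
      rw [List.map_cons, List.prod_cons, List.map_cons, List.sum_cons]
      exact ((hw x (hl x (by simp))).pow hcomm _).mul hcomm
        (ih fun y hy => hl y (List.mem_cons_of_mem _ hy))
  have h2 := h1 a.support.sort (by simp)
  have h3 : (a.support.sort.map fun x => a x • Finsupp.single x (q x)).sum = dilate q a := by
    rw [((Finset.sort_perm_toList a.support (· ≤ ·)).map _).sum_eq, Finset.sum_map_toList]
    ext x
    simp +contextual [Finset.sum_apply', Finsupp.single_apply]
  rwa [h3] at h2

end Weight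

/-! ### Quotients by relators that commute up to scalars -/

section Quotient

variable {F A X : Type*} [Field F] [Ring A] [Algebra F A] [LinearOrder X]
  {u : X → A} {wt : X → ℕ} {odd : X → Prop}

/-- Induction on the weight. Sorting a word changes it only by lower terms; if the sorted word
repeats an odd letter, the square of that letter, and hence the whole word, can be pushed to lower
weight. This allows error terms to be expanded in the PBW basis without raising the weight. -/
theorem lowerWeight_le_span
    (hcomm : ∀ x y, ∃ c : F, c ≠ 0 ∧
      u x * u y - c • (u y * u x) ∈ lowerWeight F u wt (wt x + wt y))
    (hodd : ∀ x, odd x → u x * u x ∈ lowerWeight F u wt (wt x + wt x)) (m : ℕ) :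
    lowerWeight F u wt m ≤ Submodule.span F
      (orderedProd u '' {n | (∀ x, odd x → n x ≤ 1) ∧ Finsupp.weight wt n < m}) := by
  induction m with
  | zero =>
    refine Submodule.span_le.2 ?_
    rintro _ ⟨l, hl, -⟩
    omega
  | succ m ih =>
    have hle := ih.trans (Submodule.span_mono (s := orderedProd u '' {n | (∀ x, odd x → n x ≤ 1) ∧
      Finsupp.weight wt n < m}) (t := orderedProd u '' {n | (∀ x, odd x → n x ≤ 1) ∧
      Finsupp.weight wt n < m + 1})
      (Set.image_mono fun n hn => ⟨hn.1, hn.2.trans (Nat.lt_succ_self m)⟩))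
    refine Submodule.span_le.2 ?_
    rintro _ ⟨l, hl, rfl⟩
    obtain ⟨c, -, h⟩ := hasLead_wordProd (F := F) (wt := wt) hcomm l
    rw [weight_content] at h
    have h1 := hle (lowerWeight_mono (Nat.lt_succ_iff.1 hl) h)
    have h2 : c • orderedProd u (content l) ∈ Submodule.span F
        (orderedProd u '' {n | (∀ x, odd x → n x ≤ 1) ∧ Finsupp.weight wt n < m + 1}) := by
      refine Submodule.smul_mem _ _ ?_
      by_cases had : ∀ x, odd x → content l x ≤ 1
      · exact Submodule.subset_span ⟨content l, ⟨had, by rwa [weight_content]⟩, rfl⟩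
      · push Not at had
        obtain ⟨x, hx, hlt⟩ := had
        -- Two copies of the odd letter are moved to the front, where `hodd` applies to their
        -- product.
        have hsub : List.Sublist [x, x] (sortedWord (content l)) := by
          have := List.replicate_sublist_iff (a := x) (n := 2)
            (l := sortedWord (content l))
          rw [count_sortedWord] at this
          exact this.2 hlt
        obtain ⟨l', hl'⟩ := hsub.exists_perm_append
        obtain ⟨k, hk, h3⟩ := wordProd_sub_smul_of_perm (F := F) (wt := wt) hcomm hl'
        have h4 := mul_wordProd_mem_lowerWeight l' (hodd x hx)
        have hw : ((sortedWord (content l)).map wt).sum = (l.map wt).sum := by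
          rw [sum_map_sortedWord, weight_content]
        have hw' := (hl'.map wt).sum_eq
        refine hle (lowerWeight_mono (m := (l.map wt).sum) (by omega) ?_)
        rw [orderedProd_eq_wordProd]
        rw [hw] at h3
        have h5 : wordProd u ([x, x] ++ l') ∈ lowerWeight F u wt (l.map wt).sum := by
          rw [← hw, hw']
          simpa [mul_assoc, add_assoc] using h4
        have := Submodule.add_mem _ h3 (Submodule.smul_mem _ k h5)
        simpa using this
    have := Submodule.add_mem _ h1 h2
    simpa using this

/-- Let `A` have a basis of ordered monomials in letters `u x` that commute up to scalars and terms
of lower weight, and let `w x` have leading term `u x ^ q x` and commute up to scalars with all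
letters and with each other. Then the quotient by the ideal generated by the `w x` has the basis of
ordered monomials with exponents less than `q x`. -/
theorem exists_basis_quotient
    (B : Module.Basis {n : X →₀ ℕ // ∀ x, odd x → n x ≤ 1} F A)
    (hB : ∀ n, B n = orderedProd u n.1)
    (hcomm : ∀ x y, ∃ c : F, c ≠ 0 ∧
      u x * u y - c • (u y * u x) ∈ lowerWeight F u wt (wt x + wt y))
    (hodd : ∀ x, odd x → u x * u x ∈ lowerWeight F u wt (wt x + wt x))
    (w : X → A) (q : X → ℕ) (hq : ∀ x, 0 < q x) (hq2 : ∀ x, odd x → q x = 2)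
    (hw0 : ∀ x, odd x → w x = 0)
    (hlead : ∀ x, ¬ odd x → HasLead F u wt (w x) (Finsupp.single x (q x)))
    (hwu : ∀ x y, ∃ k : F, w x * u y = k • (u y * w x))
    (hww : ∀ x y, ∃ k : F, k ≠ 0 ∧ w x * w y = k • (w y * w x))
    {A' : Type*} [Ring A'] [Algebra F A'] (φ : A →ₐ[F] A') (hφ : Function.Surjective φ)
    (hker : ∀ a, φ a = 0 ↔ a ∈ TwoSidedIdeal.span (Set.range w)) :
    ∃ B' : Module.Basis {n : X →₀ ℕ // ∀ x, n x < q x} F A',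
      ∀ n, B' n = orderedProd (fun x => φ (u x)) n.1 := by
  classical
  let N : Type _ := {n : X →₀ ℕ // ∀ x, odd x → n x ≤ 1}
  -- Division with remainder: `n` is its residue plus `q` times its quotient, and leading exponents
  -- add, so `v n` has leading exponent `n`. At odd letters the quotient is `0`, since there `n x ≤
  -- 1` and `q x = 2`, so the missing leading term of `w x` does no harm.
  let v : N → A := fun n => orderedProd u (residue q n.1) * orderedProd w (quotient q n.1)
  have hv : ∀ n : N, HasLead F u wt (v n) n.1 := by
    intro n
    have h1 : HasLead F u wt (orderedProd u (residue q n.1)) (residue q n.1) :=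
      ⟨1, one_ne_zero, by simp⟩
    have h2 : HasLead F u wt (orderedProd w (quotient q n.1)) (dilate q (quotient q n.1)) := by
      refine HasLead.orderedProd hcomm fun x hx => hlead x fun ho => hx ?_
      rw [quotient_apply, hq2 x ho]
      have := n.2 x ho
      omega
    have := h1.mul hcomm h2
    rwa [residue_add_dilate_quotient] at this
  choose c hc hvc using hv
  obtain ⟨D, hD⟩ := exists_basis_of_triangular B (fun n => Finsupp.weight wt n.1) v c hc (by
    intro n
    rw [hB]
    refine Submodule.span_mono ?_ (lowerWeight_le_span hcomm hodd _ (hvc n))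
    rintro _ ⟨m, hm, rfl⟩
    exact ⟨⟨m, hm.1⟩, hm.2, hB _⟩)
  let S : Set N := {n | ∃ x, q x ≤ n.1 x}
  have hword : ∀ a : X →₀ ℕ, ∀ x, ∃ k : F,
      orderedProd w a * w x = k • orderedProd w (a + Finsupp.single x 1) := by
    intro a x
    have hp : (sortedWord a ++ [x]).Perm (sortedWord (a + Finsupp.single x 1)) := by
      rw [List.perm_iff_count]
      intro y
      rw [List.count_append, count_sortedWord, count_sortedWord]
      simp [List.count_cons, Finsupp.single_apply]
    -- With all weights zero there is nothing of lower weight, so the congruence becomes an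
    -- equality.
    obtain ⟨k, -, h⟩ := wordProd_sub_smul_of_perm (F := F) (u := w) (wt := fun _ => 0)
      (fun x y => by
        obtain ⟨k, hk, h⟩ := hww x y
        exact ⟨k, hk, by simp [h]⟩) hp
    have hbot : ∀ l : List X, lowerWeight F w (fun _ => 0) (l.map fun _ => 0).sum = ⊥ := by
      intro l
      rw [lowerWeight, Submodule.span_eq_bot]
      rintro _ ⟨l', hl', -⟩
      simp at hl'
    rw [hbot, Submodule.mem_bot, sub_eq_zero] at h
    exact ⟨k, by simpa [orderedProd_eq_wordProd] using h⟩
  -- The left ideal generated by the `w x`. It is also a right ideal, because each `w x` moves past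
  -- any word up to a scalar.
  let K' : Submodule F A := Submodule.span F {a | ∃ t x, a = t * w x}
  have hK'l : ∀ s a, a ∈ K' → s * a ∈ K' := by
    intro s a ha
    induction ha using Submodule.span_induction with
    | mem a ha =>
      obtain ⟨t, x, rfl⟩ := ha
      exact Submodule.subset_span ⟨s * t, x, by rw [mul_assoc]⟩
    | zero => simp
    | add a b _ _ ha hb => rw [mul_add]; exact Submodule.add_mem _ ha hb
    | smul c a _ ha => rw [mul_smul_comm]; exact Submodule.smul_mem _ _ ha
  have hwl : ∀ (l : List X) x, ∃ k : F, w x * wordProd u l = k • (wordProd u l * w x) := by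
    intro l x
    induction l with
    | nil => exact ⟨1, by simp⟩
    | cons y l ih =>
      obtain ⟨k, hk⟩ := ih
      obtain ⟨k', hk'⟩ := hwu x y
      refine ⟨k' * k, ?_⟩
      rw [wordProd_cons, ← mul_assoc, hk', smul_mul_assoc, mul_assoc, hk, mul_smul_comm, smul_smul,
        mul_assoc]
  have hK'r : ∀ s a, a ∈ K' → a * s ∈ K' := by
    intro s a ha
    have hs : s ∈ Submodule.span F (Set.range B) := by rw [B.span_eq]; trivial
    induction hs using Submodule.span_induction with
    | mem s hs =>
      obtain ⟨n, rfl⟩ := hs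
      rw [hB, orderedProd_eq_wordProd]
      induction ha using Submodule.span_induction with
      | mem a ha =>
        obtain ⟨t, x, rfl⟩ := ha
        obtain ⟨k, hk⟩ := hwl (sortedWord n.1) x
        rw [mul_assoc, hk, mul_smul_comm, ← mul_assoc]
        exact Submodule.smul_mem _ _ (Submodule.subset_span ⟨_, x, rfl⟩)
      | zero => simp
      | add a b _ _ ha hb => rw [add_mul]; exact Submodule.add_mem _ ha hb
      | smul c a _ ha => rw [smul_mul_assoc]; exact Submodule.smul_mem _ _ ha
    | zero => simp
    | add a b _ _ ha hb => rw [mul_add]; exact Submodule.add_mem _ ha hb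
    | smul c a _ ha => rw [mul_smul_comm]; exact Submodule.smul_mem _ _ ha
  -- Multiplying `D n` on the right by `w x` leaves the residue alone and raises the quotient at `x`
  -- by one: the result is a multiple of `D (n + q x · x)`, whose index lies in `S`.
  have hK'K : K' ≤ Submodule.span F (D '' S) := by
    refine Submodule.span_le.2 ?_
    rintro _ ⟨t, x, rfl⟩
    have ht : t ∈ Submodule.span F (Set.range D) := by rw [D.span_eq]; trivial
    induction ht using Submodule.span_induction with
    | mem t ht =>
      obtain ⟨n, rfl⟩ := ht
      by_cases ho : odd x
      · simp [hw0 x ho]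
      · obtain ⟨k, hk⟩ := hword (quotient q n.1) x
        rw [hD]
        simp only [v]
        rw [mul_assoc, hk, mul_smul_comm]
        refine Submodule.smul_mem _ _ (Submodule.subset_span ?_)
        let n' : N := ⟨n.1 + Finsupp.single x (q x), fun y hy => by
          have hxy : x ≠ y := fun h => ho (h ▸ hy)
          simpa [Finsupp.single_apply, hxy] using n.2 y hy⟩
        refine ⟨n', ⟨x, by simp [n']⟩, ?_⟩
        rw [hD]
        simp only [v]
        congr 2
        · ext y
          by_cases hxy : x = y
          · subst hxy; simp [n']
          · simp [n', hxy]
        · ext y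
          by_cases hxy : x = y
          · subst hxy; simp [n', Nat.add_div_right _ (hq x)]
          · simp [n', hxy]
    | zero => simp
    | add a b _ _ ha hb => rw [add_mul]; exact Submodule.add_mem _ ha hb
    | smul c a _ ha => rw [smul_mul_assoc]; exact Submodule.smul_mem _ _ ha
  let J : TwoSidedIdeal A := TwoSidedIdeal.mk' K' (Submodule.zero_mem _)
    (fun hx hy => Submodule.add_mem _ hx hy) (fun hx => Submodule.neg_mem _ hx)
    (fun {x y} hy => hK'l x y hy) (fun {x y} hx => hK'r y x hx)
  have hJ : TwoSidedIdeal.span (Set.range w) ≤ J := by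
    rw [TwoSidedIdeal.span_le]
    rintro _ ⟨x, rfl⟩
    exact (TwoSidedIdeal.mem_mk' _ _ _ _ _ _ _).2 (Submodule.subset_span ⟨1, x, by simp⟩)
  have hφw : ∀ x, φ (w x) = 0 := fun x =>
    (hker _).2 (TwoSidedIdeal.subset_span ⟨x, rfl⟩)
  have hkerS : LinearMap.ker φ.toLinearMap = Submodule.span F (D '' S) := by
    apply le_antisymm
    · intro a ha
      exact hK'K ((TwoSidedIdeal.mem_mk' _ _ _ _ _ _ _).1 (hJ ((hker a).1 ha)))
    · refine Submodule.span_le.2 ?_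
      rintro _ ⟨n, ⟨x, hx⟩, rfl⟩
      rw [hD]
      change φ (v n) = 0
      have hqx : quotient q n.1 x ≠ 0 := by
        rw [quotient_apply]
        exact (Nat.div_pos hx (hq x)).ne'
      have : φ (orderedProd w (quotient q n.1)) = 0 := by
        rw [orderedProd, map_list_prod, List.map_map]
        refine List.prod_eq_zero (List.mem_map.2 ⟨x, by simpa using hqx, ?_⟩)
        change φ (w x ^ quotient q n.1 x) = 0
        rw [map_pow, hφw, zero_pow hqx]
      simp [v, this]
  obtain ⟨B', hB'⟩ := exists_basis_of_ker_eq_span D S φ.toLinearMap hφ hkerS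
  have hS : ∀ n : X →₀ ℕ, (∀ x, n x < q x) → ∀ x, odd x → n x ≤ 1 := by
    intro n hn x hx
    have := hn x
    rw [hq2 x hx] at this
    omega
  let E : {n : N // n ∉ S} ≃ {n : X →₀ ℕ // ∀ x, n x < q x} :=
    { toFun := fun n => ⟨n.1.1, fun x => by
        by_contra h
        exact n.2 ⟨x, not_lt.1 h⟩⟩
      invFun := fun n => ⟨⟨n.1, hS n.1 n.2⟩, fun ⟨x, hx⟩ => absurd (n.2 x) (not_lt.2 hx)⟩
      left_inv := fun _ => rfl
      right_inv := fun _ => rfl }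
  refine ⟨B'.reindex E, fun n => ?_⟩
  rw [Module.Basis.reindex_apply, hB', hD]
  have hn := n.2
  have e1 : residue q n.1 = n.1 := by
    ext x
    simp [Nat.mod_eq_of_lt (hn x)]
  have e2 : quotient q n.1 = 0 := by
    ext x
    simp [Nat.div_eq_of_lt (hn x)]
  change φ (orderedProd u (residue q n.1) * orderedProd w (quotient q n.1)) = _
  rw [e1, e2, orderedProd_zero, mul_one, orderedProd, map_list_prod, List.map_map, orderedProd]
  congr 2
  ext x
  simp

end Quotient

/-! ### Bicharacters, homogeneous bases and the relators of the enveloping algebra -/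

namespace Bicharacter

variable {F Γ : Type*} [Field F] [AddCommGroup Γ] (ε : Bicharacter F Γ)

theorem val_ne_zero (a b : Γ) : ε.val a b ≠ 0 := (ε.toFun a b).ne_zero

theorem val_mul_val_swap (a b : Γ) : ε.val a b * ε.val b a = 1 := by
  have := congrArg Units.val (ε.skew a b)
  simpa [val] using this

theorem val_add_right (a b c : Γ) : ε.val a (b + c) = ε.val a b * ε.val a c := by
  simp [val, ε.add_right]

theorem val_add_left (a b c : Γ) : ε.val (a + b) c = ε.val a c * ε.val b c := by
  simp [val, ε.add_left]

@[simp] theorem val_zero_left (a : Γ) : ε.val 0 a = 1 := by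
  have h := ε.val_add_left 0 0 a
  rw [add_zero] at h
  exact (mul_eq_left₀ (ε.val_ne_zero 0 a)).1 h.symm

@[simp] theorem val_zero_right (a : Γ) : ε.val a 0 = 1 := by
  have h := ε.val_mul_val_swap a 0
  rwa [val_zero_left, mul_one] at h

theorem val_nsmul_left (k : ℕ) (a b : Γ) : ε.val (k • a) b = ε.val a b ^ k := by
  induction k with
  | zero => simp
  | succ k ih => rw [succ_nsmul, val_add_left, ih, pow_succ]

theorem val_self (a : Γ) : ε.val a a = 1 ∨ ε.val a a = -1 :=
  mul_self_eq_one_iff.1 (ε.val_mul_val_swap a a)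

end Bicharacter

namespace LieColorAlgebra

variable {F Γ : Type*} [Field F] [AddCommGroup Γ] [DecidableEq Γ] {ε : Bicharacter F Γ}
  {L : Type*} [AddCommGroup L] [Module F L] (G : LieColorAlgebra ε L)

theorem bracket_self (h2 : (2 : F) ≠ 0) {α : Γ} (hα : ε.val α α = 1) {x : L} (hx : x ∈ G.deg α) :
    G.bracket x x = 0 := by
  have h := G.skew α α x x hx hx
  rw [hα, one_smul, eq_neg_iff_add_eq_zero, ← two_smul F] at h
  exact (smul_eq_zero.1 h).resolve_left h2

/-- The Jacobi identity in the form, with the scalars, in which its terms appear in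
`relator_overlap`. -/
theorem jacobi_left {α β γ : Γ} {x y z : L} (hx : x ∈ G.deg α) (hy : y ∈ G.deg β)
    (hz : z ∈ G.deg γ) :
    G.bracket x (G.bracket y z) + ε.val β γ • G.bracket (G.bracket x z) y
      - G.bracket (G.bracket x y) z = 0 := by
  have h1 : G.bracket (G.bracket x z) y
      = (ε.val (α + γ) β * ε.val α γ) • G.bracket y (G.bracket z x) := by
    rw [G.skew β (α + γ) y (G.bracket x z) hy (G.bracket_mem α γ x z hx hz),
      G.skew γ α z x hz hx]
    simp [smul_smul]
  have h2 : G.bracket (G.bracket x y) z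
      = -(ε.val (α + β) γ • G.bracket z (G.bracket x y)) :=
    G.skew γ (α + β) z (G.bracket x y) hz (G.bracket_mem α β x y hx hy)
  have h3 := G.jacobi α β γ x y z hx hy hz
  have e1 := ε.val_mul_val_swap α γ
  have e2 := ε.val_mul_val_swap β γ
  rw [h1, h2]
  simp only [ε.val_add_left]
  linear_combination (norm := module) ε.val α γ • h3
    + (e2 * ε.val α β * ε.val α γ) • G.bracket y (G.bracket z x)
    - e1 • G.bracket x (G.bracket y z)

section Basis

variable {X : Type*} (b : Module.Basis X F L)

/-- The projection of `L` onto the component of degree `γ`. -/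
def degProj (γ : Γ) : L →ₗ[F] L :=
  (G.deg γ).subtype ∘ₗ DirectSum.component F Γ (fun γ => G.deg γ) γ ∘ₗ
    (LinearEquiv.ofBijective (DirectSum.coeLinearMap G.deg) G.isInternal).symm.toLinearMap

theorem degProj_of_mem {γ α : Γ} {v : L} (hv : v ∈ G.deg α) :
    G.degProj γ v = if α = γ then v else 0 := by
  have h : (LinearEquiv.ofBijective (DirectSum.coeLinearMap G.deg) G.isInternal).symm v
      = DirectSum.lof F Γ (fun γ => G.deg γ) α ⟨v, hv⟩ := by
    rw [LinearEquiv.symm_apply_eq]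
    exact (DirectSum.coeLinearMap_lof G.deg α ⟨v, hv⟩).symm
  simp only [degProj, LinearMap.comp_apply, LinearEquiv.coe_coe, h]
  split_ifs with hα
  · subst hα
    rw [DirectSum.component.lof_self]
    rfl
  · rw [DirectSum.component.of, dif_neg hα]
    rfl

/-- The coordinate at `x` factors through the projection onto the component of degree `d x`, as a
check on the basis shows. -/
theorem repr_eq_zero_of_mem_deg {d : X → Γ} (hd : ∀ x, b x ∈ G.deg (d x)) {α : Γ} {v : L}
    (hv : v ∈ G.deg α) {x : X} (hx : d x ≠ α) : b.repr v x = 0 := by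
  have h : (b.coord x) ∘ₗ G.degProj (d x) = b.coord x := by
    refine b.ext fun y => ?_
    rw [LinearMap.comp_apply, G.degProj_of_mem (hd y)]
    split_ifs with hy
    · rfl
    · have : y ≠ x := fun h => hy (by rw [h])
      simp [this]
  have h1 := LinearMap.congr_fun h v
  rw [LinearMap.comp_apply, G.degProj_of_mem hv, if_neg (Ne.symm hx), map_zero] at h1
  simpa using h1.symm

theorem deg_le_span {d : X → Γ} (hd : ∀ x, b x ∈ G.deg (d x)) (α : Γ) :
    G.deg α ≤ Submodule.span F (b '' {x | d x = α}) := by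
  intro v hv
  rw [b.mem_span_image]
  intro x hx
  by_contra h
  exact (Finsupp.mem_support_iff.1 hx) (G.repr_eq_zero_of_mem_deg b hd hv h)

end Basis

section Relator

variable {A : Type*} [Ring A] [Algebra F A] (φ : L →ₗ[F] A)

/-- The defining relator of the enveloping algebra, evaluated in an algebra. -/
def relator (α β : Γ) (x y : L) : A :=
  φ x * φ y - ε.val α β • (φ y * φ x) - φ (G.bracket x y)

theorem relator_add_left (α β : Γ) (x x' y : L) :
    G.relator φ α β (x + x') y = G.relator φ α β x y + G.relator φ α β x' y := by
  simp only [relator, map_add, add_mul, mul_add, smul_add, LinearMap.add_apply]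
  abel

theorem relator_add_right (α β : Γ) (x y y' : L) :
    G.relator φ α β x (y + y') = G.relator φ α β x y + G.relator φ α β x y' := by
  simp only [relator, map_add, add_mul, mul_add, smul_add]
  abel

theorem relator_smul_left (α β : Γ) (c : F) (x y : L) :
    G.relator φ α β (c • x) y = c • G.relator φ α β x y := by
  simp only [relator, map_smul, smul_mul_assoc, mul_smul_comm, smul_sub, LinearMap.smul_apply]
  rw [smul_comm c]

theorem relator_smul_right (α β : Γ) (c : F) (x y : L) :
    G.relator φ α β x (c • y) = c • G.relator φ α β x y := by
  simp only [relator, map_smul, smul_mul_assoc, mul_smul_comm, smul_sub]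
  rw [smul_comm c]

theorem relator_swap {α β : Γ} {x y : L} (hx : x ∈ G.deg α) (hy : y ∈ G.deg β) :
    G.relator φ β α y x = -(ε.val β α • G.relator φ α β x y) := by
  have h := ε.val_mul_val_swap β α
  simp only [relator, G.skew α β x y hx hy, map_neg, map_smul, smul_sub, smul_smul, h, one_smul]
  abel

/-- The two ways of resolving the ambiguity `x y z`. After expansion the cubic terms cancel, the
quadratic ones agree on both sides, and the linear ones vanish by the Jacobi identity. The
right-hand side involves only relators in which a bracket fills one place, which have shorter
leading words. -/
theorem relator_overlap {α β γ : Γ} {x y z : L} (hx : x ∈ G.deg α) (hy : y ∈ G.deg β)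
    (hz : z ∈ G.deg γ) :
    G.relator φ α β x y * φ z + ε.val α β • (φ y * G.relator φ α γ x z)
      + (ε.val α β * ε.val α γ) • (G.relator φ β γ y z * φ x)
      - φ x * G.relator φ β γ y z - ε.val β γ • (G.relator φ α γ x z * φ y)
      - (ε.val β γ * ε.val α γ) • (φ z * G.relator φ α β x y)
    = G.relator φ α (β + γ) x (G.bracket y z)
      + ε.val β γ • G.relator φ (α + γ) β (G.bracket x z) y
      - G.relator φ (α + β) γ (G.bracket x y) z := by
  have h := congrArg φ (G.jacobi_left hx hy hz)
  simp only [map_add, map_sub, map_smul, map_zero] at h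
  have e := ε.val_mul_val_swap β γ
  simp only [relator, ε.val_add_left, ε.val_add_right, mul_sub, sub_mul, smul_sub,
    smul_mul_assoc, mul_smul_comm, mul_assoc]
  linear_combination (norm := module) h + (e * ε.val α β) • (φ y * φ (G.bracket x z))

end Relator

end LieColorAlgebra

/-! ### The diamond lemma: ranks of words and resolution of ambiguities -/

section Rank

variable {X : Type*} [LinearOrder X]

/-- The number of inversions of a word. -/
def inversions : List X → ℕ
  | [] => 0
  | x :: l => l.countP (· < x) + inversions l

theorem inversions_append (l m : List X) :
    inversions (l ++ m)
      = inversions l + inversions m + (l.map fun x => m.countP (· < x)).sum := by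
  induction l with
  | nil => simp [inversions]
  | cons x l ih =>
    simp only [List.cons_append, inversions, ih, List.countP_append, List.map_cons, List.sum_cons]
    omega

/-- The rank of a word: its length, and then its number of inversions. -/
def wordRank (l : List X) : ℕ ×ₗ ℕ := toLex (l.length, inversions l)

theorem wordRank_lt_of_length {l m : List X} (h : l.length < m.length) :
    wordRank l < wordRank m :=
  Prod.Lex.toLex_lt_toLex.2 (Or.inl h)

/-- Inversions between the factor and its surroundings depend only on the letters of the factor, so
only its inner inversions change. -/
theorem wordRank_lt_of_perm {l m : List X} (hp : l.Perm m) (h : inversions l < inversions m)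
    (A B : List X) : wordRank (A ++ (l ++ B)) < wordRank (A ++ (m ++ B)) := by
  refine Prod.Lex.toLex_lt_toLex.2 (Or.inr ⟨by simp [hp.length_eq], ?_⟩)
  have h1 : (l.map fun x => B.countP (· < x)).sum = (m.map fun x => B.countP (· < x)).sum :=
    (hp.map _).sum_eq
  have h2 : ∀ x, l.countP (· < x) = m.countP (· < x) := fun x => hp.countP_eq _
  simp only [inversions_append, List.countP_append, h1, h2]
  omega

end Rank

namespace LieColorAlgebra

variable {F Γ : Type*} [Field F] [AddCommGroup Γ] [DecidableEq Γ] {ε : Bicharacter F Γ}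
  {L : Type*} [AddCommGroup L] [Module F L] (G : LieColorAlgebra ε L)
  {X : Type*} [LinearOrder X] (b : Module.Basis X F L) (d : X → Γ)

/-- The image of a basis element in the tensor algebra. -/
def letter (x : X) : TensorAlgebra F L := TensorAlgebra.ι F (b x)

/-- The relator of two basis elements in the tensor algebra. -/
def basisRelator (x y : X) : TensorAlgebra F L :=
  G.relator (TensorAlgebra.ι F) (d x) (d y) (b x) (b y)

variable (ε) in
/-- The word `x y` is the leading word of a relator. -/
def IsBad (x y : X) : Prop := y < x ∨ (x = y ∧ ε.val (d x) (d x) = -1)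

/-- The span of the relators, multiplied from both sides by words, whose leading words have rank
less than `r`. -/
def relatorSpan (r : ℕ ×ₗ ℕ) : Submodule F (TensorAlgebra F L) :=
  Submodule.span F {t | ∃ A x y B, IsBad ε d x y ∧ wordRank (A ++ ([x, y] ++ B)) < r ∧
    t = wordProd (letter b) A * G.basisRelator b d x y * wordProd (letter b) B}

variable {d}

omit [LinearOrder X] in
theorem wordProd_letter (l : List X) :
    wordProd (letter b) l = b.tensorAlgebra (FreeMonoid.ofList l) := by
  have h1 : FreeAlgebra.basisFreeMonoid F X (FreeMonoid.ofList l)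
      = (l.map (FreeAlgebra.ι F)).prod := by
    simp [FreeAlgebra.basisFreeMonoid, FreeAlgebra.equivMonoidAlgebraFreeMonoid]
  rw [Module.Basis.tensorAlgebra, Module.Basis.map_apply, h1]
  change _ = (TensorAlgebra.equivFreeAlgebra b).symm _
  rw [map_list_prod, List.map_map, wordProd]
  congr 2
  ext x
  simp [letter]

omit [LinearOrder X] in
theorem mul_ι_mul_mem (v : L) (s t : TensorAlgebra F L) (P : Submodule F (TensorAlgebra F L))
    (h : ∀ x, s * letter b x * t ∈ P) : s * TensorAlgebra.ι F v * t ∈ P := by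
  have hv : v ∈ Submodule.span F (Set.range b) := by rw [b.span_eq]; trivial
  induction hv using Submodule.span_induction with
  | mem v hv => obtain ⟨x, rfl⟩ := hv; exact h x
  | zero => simp
  | add v w _ _ hv hw => rw [map_add, mul_add, add_mul]; exact Submodule.add_mem _ hv hw
  | smul c v _ hv =>
    rw [map_smul, mul_smul_comm, smul_mul_assoc]
    exact Submodule.smul_mem _ _ hv

variable (hd : ∀ x, b x ∈ G.deg (d x)) (h2 : (2 : F) ≠ 0) (h3 : (3 : F) ≠ 0)
include hd h2

/-- The pair need not be bad: for `x < y` the relator is a multiple of the one for the swapped, bad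
pair, and for equal even letters it vanishes. Only the length of the surrounding word has to be
controlled. -/
theorem mul_basisRelator_mul_mem (A B : List X) (x y : X) {n k : ℕ}
    (h : A.length + B.length + 2 < n) :
    wordProd (letter b) A * G.basisRelator b d x y * wordProd (letter b) B
      ∈ G.relatorSpan b d (toLex (n, k)) := by
  have hlt : ∀ x y : X, wordRank (A ++ ([x, y] ++ B)) < toLex (n, k) := fun x y =>
    Prod.Lex.toLex_lt_toLex.2 (Or.inl (by simp; omega))
  rcases lt_trichotomy x y with hxy | rfl | hxy
  · have h1 : G.basisRelator b d x y = -(ε.val (d x) (d y) • G.basisRelator b d y x) :=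
      G.relator_swap _ (hd y) (hd x)
    rw [h1, mul_neg, neg_mul, mul_smul_comm, smul_mul_assoc]
    exact Submodule.neg_mem _ (Submodule.smul_mem _ _
      (Submodule.subset_span ⟨A, y, x, B, Or.inl hxy, hlt _ _, rfl⟩))
  · rcases ε.val_self (d x) with hx | hx
    · have h1 : G.basisRelator b d x x = 0 := by
        simp [basisRelator, relator, hx, G.bracket_self h2 hx (hd x)]
      simp [h1]
    · exact Submodule.subset_span ⟨A, x, x, B, Or.inr ⟨rfl, hx⟩, hlt _ _, rfl⟩
  · exact Submodule.subset_span ⟨A, x, y, B, Or.inl hxy, hlt _ _, rfl⟩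

theorem mul_relator_mul_mem (A B : List X) {α β : Γ} {v w : L} (hv : v ∈ G.deg α)
    (hw : w ∈ G.deg β) {n k : ℕ} (h : A.length + B.length + 2 < n) :
    wordProd (letter b) A * G.relator (TensorAlgebra.ι F) α β v w * wordProd (letter b) B
      ∈ G.relatorSpan b d (toLex (n, k)) := by
  have hv' := G.deg_le_span b hd α hv
  have hw' := G.deg_le_span b hd β hw
  clear hv hw
  induction hv' using Submodule.span_induction with
  | mem v hv' =>
    obtain ⟨x, rfl, rfl⟩ := hv'
    induction hw' using Submodule.span_induction with
    | mem w hw' =>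
      obtain ⟨y, rfl, rfl⟩ := hw'
      exact G.mul_basisRelator_mul_mem b hd h2 A B x y h
    | zero => simp [relator]
    | add w w' h1 h2 ih1 ih2 =>
      rw [relator_add_right, mul_add, add_mul]
      exact Submodule.add_mem _ ih1 ih2
    | smul c w h1 ih =>
      rw [relator_smul_right, mul_smul_comm, smul_mul_assoc]
      exact Submodule.smul_mem _ _ ih
  | zero => simp [relator]
  | add v v' h1 h2 ih1 ih2 =>
    rw [relator_add_left, mul_add, add_mul]
    exact Submodule.add_mem _ ih1 ih2
  | smul c v h1 ih =>
    rw [relator_smul_left, mul_smul_comm, smul_mul_assoc]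
    exact Submodule.smul_mem _ _ ih

end LieColorAlgebra

namespace LieColorAlgebra

variable {F Γ : Type*} [Field F] [AddCommGroup Γ] [DecidableEq Γ] {ε : Bicharacter F Γ}
  {L : Type*} [AddCommGroup L] [Module F L] (G : LieColorAlgebra ε L)
  {X : Type*} [LinearOrder X] (b : Module.Basis X F L) {d : X → Γ}

variable (F) in
/-- The coefficient of the leading word `x y` of a relator. -/
def leadCoeff (x y : X) : F := if x = y then 2 else 1

/-- The relator minus its leading term involves only a bracket, which is a combination of single
letters, and, if `x ≠ y`, the swapped word. For `x = y` the letter is odd and the swapped term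
merges with the leading one, whence the coefficient `2`. -/
theorem mul_lowerPart_mul_mem (d : X → Γ) {x y : X} (hbad : IsBad ε d x y)
    (s t : TensorAlgebra F L)
    (P : Submodule F (TensorAlgebra F L)) (h : ∀ k, s * letter b k * t ∈ P)
    (h' : x ≠ y → s * (letter b y * letter b x) * t ∈ P) :
    s * (leadCoeff F x y • (letter b x * letter b y) - G.basisRelator b d x y) * t ∈ P := by
  have hb := mul_ι_mul_mem b (G.bracket (b x) (b y)) s t P h
  by_cases hxy : x = y
  · subst hxy
    have hε : ε.val (d x) (d x) = -1 := by
      rcases hbad with h | h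
      · exact absurd h (lt_irrefl x)
      · exact h.2
    have e : leadCoeff F x x • (letter b x * letter b x) - G.basisRelator b d x x
        = TensorAlgebra.ι F (G.bracket (b x) (b x)) := by
      simp only [leadCoeff, if_true, basisRelator, relator, letter, hε]
      module
    rwa [e]
  · have e : leadCoeff F x y • (letter b x * letter b y) - G.basisRelator b d x y
        = ε.val (d x) (d y) • (letter b y * letter b x)
          + TensorAlgebra.ι F (G.bracket (b x) (b y)) := by
      simp only [leadCoeff, hxy, if_false, basisRelator, relator, letter]
      module
    rw [e, mul_add, add_mul, mul_smul_comm, smul_mul_assoc]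
    exact Submodule.add_mem _ (Submodule.smul_mem _ _ (h' hxy)) hb

theorem inversions_swap_lt {x y : X} (h : y < x) : inversions [y, x] < inversions [x, y] := by
  simp [inversions, h, h.le]

omit [DecidableEq Γ] in
theorem IsBad.lt_of_ne {x y : X} (h : IsBad ε d x y) (hxy : x ≠ y) : y < x :=
  h.resolve_right fun h => hxy h.1

/-- For relators `r`, `r'` with leading terms `m`, `m'` at disjoint places, `r B m' - m B r' = r B
(m' - r') - (m - r) B r'`, and the lower parts on the right give words of smaller rank. -/
theorem disjoint_mem (A B C : List X) {x y x' y' : X} (hb : IsBad ε d x y)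
    (hb' : IsBad ε d x' y') :
    leadCoeff F x' y' • (wordProd (letter b) A * G.basisRelator b d x y
        * wordProd (letter b) (B ++ ([x', y'] ++ C)))
      - leadCoeff F x y • (wordProd (letter b) (A ++ ([x, y] ++ B)) * G.basisRelator b d x' y'
        * wordProd (letter b) C)
      ∈ G.relatorSpan b d (wordRank (A ++ ([x, y] ++ (B ++ ([x', y'] ++ C))))) := by
  have h1 := G.mul_lowerPart_mul_mem b d hb'
    (wordProd (letter b) A * G.basisRelator b d x y * wordProd (letter b) B)
    (wordProd (letter b) C)
    (G.relatorSpan b d (wordRank (A ++ ([x, y] ++ (B ++ ([x', y'] ++ C))))))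
    (fun k => Submodule.subset_span ⟨A, x, y, B ++ ([k] ++ C), hb,
      wordRank_lt_of_length (by simp), by simp [mul_assoc]⟩)
    (fun hne => Submodule.subset_span ⟨A, x, y, B ++ ([y', x'] ++ C), hb, by
      have := wordRank_lt_of_perm (List.Perm.swap x' y' [])
        (inversions_swap_lt (hb'.lt_of_ne hne)) (A ++ ([x, y] ++ B)) C
      simpa using this, by simp [mul_assoc]⟩)
  have h2 := G.mul_lowerPart_mul_mem b d hb
    (wordProd (letter b) A)
    (wordProd (letter b) B * G.basisRelator b d x' y' * wordProd (letter b) C)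
    (G.relatorSpan b d (wordRank (A ++ ([x, y] ++ (B ++ ([x', y'] ++ C))))))
    (fun k => Submodule.subset_span ⟨A ++ ([k] ++ B), x', y', C, hb',
      wordRank_lt_of_length (by simp), by simp [mul_assoc]⟩)
    (fun hne => Submodule.subset_span ⟨A ++ ([y, x] ++ B), x', y', C, hb', by
      have := wordRank_lt_of_perm (List.Perm.swap x y [])
        (inversions_swap_lt (hb.lt_of_ne hne)) A (B ++ ([x', y'] ++ C))
      simpa using this, by simp [mul_assoc]⟩)
  convert Submodule.sub_mem _ h1 h2 using 1
  simp only [wordProd_append, wordProd_cons, wordProd_nil, mul_one, mul_sub, sub_mul, mul_assoc,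
    mul_smul_comm, smul_mul_assoc]
  abel

theorem overlap_mem (hd : ∀ x, b x ∈ G.deg (d x)) (h2 : (2 : F) ≠ 0) (h3 : (3 : F) ≠ 0)
    (A B : List X) {x y z : X} (hxy : IsBad ε d x y) (hyz : IsBad ε d y z) :
    leadCoeff F y z • (wordProd (letter b) A * G.basisRelator b d x y
        * wordProd (letter b) (z :: B))
      - leadCoeff F x y • (wordProd (letter b) (A ++ [x]) * G.basisRelator b d y z
        * wordProd (letter b) B)
      ∈ G.relatorSpan b d (wordRank (A ++ ([x, y, z] ++ B))) := by
  let r := wordRank (A ++ ([x, y, z] ++ B))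
  let S : Submodule F (TensorAlgebra F L) := (G.relatorSpan b d r).comap
    (LinearMap.mulRight F (wordProd (letter b) B) ∘ₗ LinearMap.mulLeft F (wordProd (letter b) A))
  have hS : ∀ t, t ∈ S ↔
      wordProd (letter b) A * t * wordProd (letter b) B ∈ G.relatorSpan b d r := fun t => Iff.rfl
  suffices hmain : leadCoeff F y z • (G.basisRelator b d x y * letter b z)
      - leadCoeff F x y • (letter b x * G.basisRelator b d y z) ∈ S by
    rw [hS] at hmain
    convert hmain using 1
    simp only [wordProd_append, wordProd_cons, wordProd_nil, mul_one, mul_sub, sub_mul, mul_assoc,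
      mul_smul_comm, smul_mul_assoc]
  have hid := G.relator_overlap (TensorAlgebra.ι F) (hd x) (hd y) (hd z)
  -- Each of these relators has leading words of length two in place of the three letters `x y z`,
  -- so they lie in the span by length alone.
  have hE : G.relator (TensorAlgebra.ι F) (d x) (d y + d z) (b x) (G.bracket (b y) (b z))
      + ε.val (d y) (d z) • G.relator (TensorAlgebra.ι F) (d x + d z) (d y)
          (G.bracket (b x) (b z)) (b y)
      - G.relator (TensorAlgebra.ι F) (d x + d y) (d z) (G.bracket (b x) (b y)) (b z) ∈ S := by
    have hr : ∀ α β v w, v ∈ G.deg α → w ∈ G.deg β →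
        G.relator (TensorAlgebra.ι F) α β v w ∈ S := fun α β v w hv hw =>
      G.mul_relator_mul_mem b hd h2 A B hv hw (by simp; omega)
    exact Submodule.sub_mem _ (Submodule.add_mem _
      (hr _ _ _ _ (hd x) (G.bracket_mem _ _ _ _ (hd y) (hd z)))
      (Submodule.smul_mem _ _ (hr _ _ _ _ (G.bracket_mem _ _ _ _ (hd x) (hd z)) (hd y))))
      (hr _ _ _ _ (G.bracket_mem _ _ _ _ (hd x) (hd y)) (hd z))
  rw [← hid] at hE
  have hleft : ∀ k u v, IsBad ε d u v → [k, u, v].Perm [x, y, z] →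
      inversions [k, u, v] < inversions [x, y, z] →
      letter b k * G.basisRelator b d u v ∈ S := by
    intro k u v hb hp hi
    refine Submodule.subset_span ⟨A ++ [k], u, v, B, hb, ?_, by simp [mul_assoc]⟩
    have := wordRank_lt_of_perm hp hi A B
    simpa [r] using this
  have hright : ∀ k u v, IsBad ε d u v → [u, v, k].Perm [x, y, z] →
      inversions [u, v, k] < inversions [x, y, z] →
      G.basisRelator b d u v * letter b k ∈ S := by
    intro k u v hb hp hi
    refine Submodule.subset_span ⟨A, u, v, k :: B, hb, ?_, by simp [mul_assoc]⟩
    have := wordRank_lt_of_perm hp hi A B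
    simpa [r] using this
  have pyxz : [y, x, z].Perm [x, y, z] := List.Perm.swap x y [z]
  have pyzx : [y, z, x].Perm [x, y, z] := List.perm_append_comm (l₁ := [y, z]) (l₂ := [x])
  have pxzy : [x, z, y].Perm [x, y, z] := (List.Perm.swap y z []).cons x
  have pzxy : [z, x, y].Perm [x, y, z] := List.perm_append_comm (l₁ := [z]) (l₂ := [x, y])
  change G.basisRelator b d x y * letter b z
    + ε.val (d x) (d y) • (letter b y * G.basisRelator b d x z)
    + (ε.val (d x) (d y) * ε.val (d x) (d z)) • (G.basisRelator b d y z * letter b x)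
    - letter b x * G.basisRelator b d y z
    - ε.val (d y) (d z) • (G.basisRelator b d x z * letter b y)
    - (ε.val (d y) (d z) * ε.val (d x) (d z)) • (letter b z * G.basisRelator b d x y) ∈ S at hE
  rcases eq_or_ne x y with rfl | hxy'
  · have hε : ε.val (d x) (d x) = -1 := (hxy.resolve_left (lt_irrefl x)).2
    rcases eq_or_ne x z with rfl | hyz'
    · rw [hε] at hE
      -- For a triple odd letter the overlap identity gives three times the commutator of the
      -- relator with the letter, whereas twice it is wanted. Here `3` must be invertible.
      have := Submodule.smul_mem S (2 / 3 : F) hE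
      convert this using 1
      simp only [leadCoeff, if_true]
      match_scalars <;> field_simp <;> ring
    · have hlt := hyz.lt_of_ne hyz'
      have f2 := hright x x z hyz pxzy (by simp [inversions, hlt, hlt.le])
      have f4 := hleft z x x hxy pzxy (by simp [inversions, hlt, hlt.le])
      rw [hε] at hE
      have := Submodule.add_mem _ hE (Submodule.add_mem _
        (Submodule.smul_mem _ (2 * ε.val (d x) (d z)) f2)
        (Submodule.smul_mem _ (ε.val (d x) (d z) * ε.val (d x) (d z)) f4))
      convert this using 1
      simp only [leadCoeff, if_true, hyz', if_false]
      module
  · have hlt := hxy.lt_of_ne hxy'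
    rcases eq_or_ne y z with rfl | hyz'
    · have hε : ε.val (d y) (d y) = -1 := (hyz.resolve_left (lt_irrefl y)).2
      have f1 := hleft y x y hxy pyxz (by simp [inversions, hlt, hlt.le])
      have f2 := hright x y y hyz pyzx (by simp [inversions, hlt, hlt.le])
      rw [hε] at hE
      have := Submodule.sub_mem _ hE (Submodule.add_mem _
        (Submodule.smul_mem _ (2 * ε.val (d x) (d y)) f1)
        (Submodule.smul_mem _ (ε.val (d x) (d y) * ε.val (d x) (d y)) f2))
      convert this using 1
      simp only [leadCoeff, if_true, hxy', if_false]
      module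
    · have hlt' := hyz.lt_of_ne hyz'
      have hlt'' := hlt'.trans hlt
      have hxz : IsBad ε d x z := Or.inl hlt''
      have f1 := hleft y x z hxz pyxz (by
        simp [inversions, hlt, hlt.le, hlt', hlt''])
      have f2 := hright x y z hyz pyzx (by
        simp [inversions, hlt, hlt.le, hlt', hlt'', hlt''.le])
      have f3 := hright y x z hxz pxzy (by
        simp [inversions, hlt, hlt', hlt'.le, hlt''])
      have f4 := hleft z x y hxy pzxy (by
        simp [inversions, hlt, hlt', hlt'.le, hlt'', hlt''.le])
      have := Submodule.add_mem _ (Submodule.sub_mem _ hE (Submodule.add_mem _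
        (Submodule.smul_mem _ (ε.val (d x) (d y)) f1)
        (Submodule.smul_mem _ (ε.val (d x) (d y) * ε.val (d x) (d z)) f2)))
        (Submodule.add_mem _ (Submodule.smul_mem _ (ε.val (d y) (d z)) f3)
        (Submodule.smul_mem _ (ε.val (d y) (d z) * ε.val (d x) (d z)) f4))
      convert this using 1
      simp only [leadCoeff, hxy', hyz', if_false]
      module

/-- Two relators with the same leading word agree up to relators with smaller leading words. -/
theorem confluence (hd : ∀ x, b x ∈ G.deg (d x)) (h2 : (2 : F) ≠ 0) (h3 : (3 : F) ≠ 0)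
    {A B A' B' : List X} {x y x' y' : X} (hb : IsBad ε d x y) (hb' : IsBad ε d x' y')
    (h : A ++ ([x, y] ++ B) = A' ++ ([x', y'] ++ B')) :
    leadCoeff F x' y' • (wordProd (letter b) A * G.basisRelator b d x y * wordProd (letter b) B)
      - leadCoeff F x y • (wordProd (letter b) A' * G.basisRelator b d x' y'
        * wordProd (letter b) B')
      ∈ G.relatorSpan b d (wordRank (A ++ ([x, y] ++ B))) := by
  -- `t` is the offset of the second leading pair: offset zero means the same pair, one an overlap
  -- in a single letter, two or more disjoint pairs.
  have key : ∀ {A B B' : List X} {x y x' y' : X} (t : List X), IsBad ε d x y →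
      IsBad ε d x' y' → [x, y] ++ B = t ++ ([x', y'] ++ B') →
      leadCoeff F x' y' • (wordProd (letter b) A * G.basisRelator b d x y * wordProd (letter b) B)
        - leadCoeff F x y • (wordProd (letter b) (A ++ t) * G.basisRelator b d x' y'
          * wordProd (letter b) B')
        ∈ G.relatorSpan b d (wordRank (A ++ ([x, y] ++ B))) := by
    intro A B B' x y x' y' t hb hb' h
    match t, h with
    | [], h =>
      simp only [List.nil_append, List.cons_append, List.cons.injEq] at h
      obtain ⟨rfl, rfl, rfl⟩ := h
      simp
    | [a], h =>
      simp only [List.nil_append, List.cons_append, List.cons.injEq] at h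
      obtain ⟨rfl, rfl, rfl⟩ := h
      have := G.overlap_mem b hd h2 h3 A B' hb hb'
      simpa using this
    | a :: c :: t, h =>
      simp only [List.nil_append, List.cons_append, List.cons.injEq] at h
      obtain ⟨rfl, rfl, rfl⟩ := h
      have := G.disjoint_mem b A t B' hb hb'
      simpa using this
  rcases List.append_eq_append_iff.1 h with ⟨t, rfl, h'⟩ | ⟨t, rfl, h'⟩
  · exact key t hb hb' h'
  · rw [h]
    have := Submodule.neg_mem _ (key (A := A') t hb' hb h')
    rwa [neg_sub] at this

end LieColorAlgebra

/-! ### The Poincaré–Birkhoff–Witt theorem -/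

namespace LieColorAlgebra

variable {F Γ : Type*} [Field F] [AddCommGroup Γ] [DecidableEq Γ] {ε : Bicharacter F Γ}
  {L : Type*} [AddCommGroup L] [Module F L] (G : LieColorAlgebra ε L)
  {X : Type*} [LinearOrder X] (b : Module.Basis X F L) {d : X → Γ}

variable (ε d) in
/-- The words with a leading word of a relator as a factor. -/
def reducibleWords : Set (List X) := {l | ∃ A x y B, IsBad ε d x y ∧ l = A ++ ([x, y] ++ B)}

-- "Not bad" is a transitive relation, so from adjacent letters it extends to all pairs of letters
-- in the word, which excludes two copies of an odd letter.
omit [DecidableEq Γ] in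
theorem content_le_one {l : List X} (hl : l ∉ reducibleWords ε d) {x : X}
    (hx : ε.val (d x) (d x) = -1) : content l x ≤ 1 := by
  have hc : l.IsChain fun x y => ¬ IsBad ε d x y :=
    List.isChain_iff_forall_rel_of_append_cons_cons.2 fun x y A B h hb => hl ⟨A, x, y, B, hb, h⟩
  have : IsTrans X fun x y => ¬ IsBad ε d x y := ⟨by
    intro x y z hxy hyz hxz
    simp only [IsBad, not_or, not_lt, not_and] at hxy hyz
    rcases hxz with h | ⟨rfl, h⟩
    · exact absurd h (not_lt.2 (hxy.1.trans hyz.1))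
    · exact hxy.2 (le_antisymm hxy.1 hyz.1) h⟩
  have hp := hc.pairwise
  by_contra! hlt
  rw [content_apply] at hlt
  have hsub : List.Sublist [x, x] l := (List.replicate_sublist_iff (n := 2)).2 hlt
  have := hp.sublist hsub
  simp [IsBad, hx] at this

omit [DecidableEq Γ] in
theorem pairwise_of_not_mem_reducibleWords {l : List X} (hl : l ∉ reducibleWords ε d) :
    l.Pairwise (· ≤ ·) := by
  refine List.IsChain.pairwise ?_
  refine List.isChain_iff_forall_rel_of_append_cons_cons.2 fun {x y A B} h => ?_
  by_contra hlt
  exact hl ⟨A, x, y, B, Or.inl (not_le.1 hlt), h⟩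

omit [DecidableEq Γ] in
theorem sortedWord_not_mem_reducibleWords {n : X →₀ ℕ}
    (hn : ∀ x, ε.val (d x) (d x) = -1 → n x ≤ 1) : sortedWord n ∉ reducibleWords ε d := by
  rintro ⟨A, x, y, B, hb, h⟩
  have hp := pairwise_sortedWord n
  have hsub : List.Sublist [x, y] (sortedWord n) := by
    rw [h]
    exact (List.sublist_append_left _ _).trans (List.sublist_append_right _ _)
  have hle := hp.sublist hsub
  simp only [List.pairwise_cons, List.mem_singleton, forall_eq] at hle
  rcases hb with hlt | ⟨rfl, hx⟩
  · exact absurd hlt (not_lt.2 hle.1)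
  · have := (List.replicate_sublist_iff (n := 2)).1 hsub
    rw [count_sortedWord] at this
    have := hn x hx
    omega

/-- Irreducible words correspond to exponents that are at most one on odd letters. -/
def irreducibleWordsEquiv :
    {l : List X // l ∉ reducibleWords ε d} ≃
      {n : X →₀ ℕ // ∀ x, ε.val (d x) (d x) = -1 → n x ≤ 1} where
  toFun l := ⟨content l.1, fun _ hx => content_le_one l.2 hx⟩
  invFun n := ⟨sortedWord n.1, sortedWord_not_mem_reducibleWords n.2⟩
  left_inv l := Subtype.ext (sortedWord_content (pairwise_of_not_mem_reducibleWords l.2))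
  right_inv n := Subtype.ext (content_sortedWord n.1)

omit [LinearOrder X] in
theorem map_wordProd {A B : Type*} [Ring A] [Ring B] [Algebra F A] [Algebra F B] (φ : A →ₐ[F] B)
    (u : X → A) (l : List X) : φ (wordProd u l) = wordProd (fun x => φ (u x)) l := by
  rw [wordProd, map_list_prod, List.map_map]
  rfl

/-- The Poincaré–Birkhoff–Witt theorem for Lie color algebras. -/
theorem exists_pbw_basis (hd : ∀ x, b x ∈ G.deg (d x)) (h2 : (2 : F) ≠ 0) (h3 : (3 : F) ≠ 0) :
    ∃ B : Module.Basis {n : X →₀ ℕ // ∀ x, ε.val (d x) (d x) = -1 → n x ≤ 1} F G.Enveloping,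
      ∀ n, B n = orderedProd (fun x => G.envι (b x)) n.1 := by
  classical
  let W : Module.Basis (List X) F (TensorAlgebra F L) :=
    b.tensorAlgebra.reindex FreeMonoid.toList
  have hW : ∀ l, W l = wordProd (letter b) l := fun l => by
    rw [wordProd_letter, Module.Basis.reindex_apply]
    rfl
  let γ : List X → X → X → List X → TensorAlgebra F L := fun A x y B =>
    wordProd (letter b) A * G.basisRelator b d x y * wordProd (letter b) B
  have hκ : ∀ x y : X, leadCoeff F x y ≠ 0 := fun x y => by
    unfold leadCoeff
    split_ifs
    exacts [h2, one_ne_zero]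
  -- A triangular family indexed by all words: an irreducible word stands for itself, a reducible
  -- one is replaced by one chosen multiple of a relator with that leading word.
  have hv : ∀ l : List X, ∃ (c : F) (t : TensorAlgebra F L), c ≠ 0 ∧
      (l ∉ reducibleWords ε d → t = W l) ∧
      (l ∈ reducibleWords ε d → ∃ A x y B, IsBad ε d x y ∧ l = A ++ ([x, y] ++ B) ∧
        t = γ A x y B) ∧
      t - c • W l ∈ Submodule.span F (W '' {m | wordRank m < wordRank l}) := by
    intro l
    by_cases hl : l ∈ reducibleWords ε d
    · obtain ⟨A, x, y, B, hb, rfl⟩ := hl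
      refine ⟨leadCoeff F x y, γ A x y B, hκ x y, fun h => absurd ⟨A, x, y, B, hb, rfl⟩ h,
        fun _ => ⟨A, x, y, B, hb, rfl, rfl⟩, ?_⟩
      have := G.mul_lowerPart_mul_mem b d hb (wordProd (letter b) A) (wordProd (letter b) B)
        (Submodule.span F (W '' {m | wordRank m < wordRank (A ++ ([x, y] ++ B))}))
        (fun k => Submodule.subset_span ⟨A ++ ([k] ++ B), wordRank_lt_of_length (by simp), by
          rw [hW]; simp [mul_assoc]⟩)
        (fun hne => Submodule.subset_span ⟨A ++ ([y, x] ++ B),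
          wordRank_lt_of_perm (List.Perm.swap x y []) (inversions_swap_lt (hb.lt_of_ne hne)) A B, by
          rw [hW]; simp [mul_assoc]⟩)
      convert Submodule.neg_mem _ this using 1
      rw [hW]
      simp only [γ, wordProd_append, wordProd_cons, wordProd_nil, mul_one, mul_sub, sub_mul,
        mul_assoc, mul_smul_comm, smul_mul_assoc]
      abel
    · exact ⟨1, W l, one_ne_zero, fun _ => rfl, fun h => absurd h hl, by simp⟩
  choose c v hc hirr hred hlow using hv
  obtain ⟨D, hD⟩ := exists_basis_of_triangular W wordRank v c hc hlow
  -- The choice is immaterial: by confluence any other multiple with the same leading word differs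
  -- from a scalar times the chosen one by multiples of smaller rank.
  have hγ : ∀ (r : ℕ ×ₗ ℕ) A x y B, IsBad ε d x y → wordRank (A ++ ([x, y] ++ B)) = r →
      γ A x y B ∈ Submodule.span F (D '' reducibleWords ε d) := by
    intro r
    induction r using WellFoundedLT.induction with
    | ind r ih =>
      rintro A x y B hb rfl
      have hmem : A ++ ([x, y] ++ B) ∈ reducibleWords ε d := ⟨A, x, y, B, hb, rfl⟩
      obtain ⟨A', x', y', B', hb', h, ht⟩ := hred _ hmem
      have h1 := G.confluence b hd h2 h3 hb hb' h
      have h3 : G.relatorSpan b d (wordRank (A ++ ([x, y] ++ B)))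
          ≤ Submodule.span F (D '' reducibleWords ε d) := by
        refine Submodule.span_le.2 ?_
        rintro _ ⟨A, x, y, B, hb, hlt, rfl⟩
        exact ih _ hlt A x y B hb rfl
      have h4 : γ A' x' y' B' ∈ Submodule.span F (D '' reducibleWords ε d) :=
        Submodule.subset_span ⟨_, hmem, by rw [hD, ht]⟩
      have h5 := Submodule.add_mem _ (h3 h1) (Submodule.smul_mem _ (leadCoeff F x y) h4)
      rw [sub_add_cancel] at h5
      exact (Submodule.smul_mem_iff _ (hκ x' y')).1 h5
  let K : Submodule F (TensorAlgebra F L) :=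
    Submodule.span F {t | ∃ A x y B, IsBad ε d x y ∧ t = γ A x y B}
  have hKD : K ≤ Submodule.span F (D '' reducibleWords ε d) := by
    refine Submodule.span_le.2 ?_
    rintro _ ⟨A, x, y, B, hb, rfl⟩
    exact hγ _ A x y B hb rfl
  have htop : ∀ t, t ∈ Submodule.span F (Set.range W) := fun t => by rw [W.span_eq]; trivial
  have hKl : ∀ s a, a ∈ K → s * a ∈ K := by
    intro s a ha
    induction htop s using Submodule.span_induction with
    | mem s hs =>
      obtain ⟨l, rfl⟩ := hs
      induction ha using Submodule.span_induction with
      | mem a ha =>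
        obtain ⟨A, x, y, B, hb, rfl⟩ := ha
        exact Submodule.subset_span ⟨l ++ A, x, y, B, hb, by simp [γ, hW, mul_assoc]⟩
      | zero => simp
      | add a b _ _ ha hb => rw [mul_add]; exact Submodule.add_mem _ ha hb
      | smul c a _ ha => rw [mul_smul_comm]; exact Submodule.smul_mem _ _ ha
    | zero => simp
    | add a b _ _ ha hb => rw [add_mul]; exact Submodule.add_mem _ ha hb
    | smul c a _ ha => rw [smul_mul_assoc]; exact Submodule.smul_mem _ _ ha
  have hKr : ∀ s a, a ∈ K → a * s ∈ K := by
    intro s a ha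
    induction htop s using Submodule.span_induction with
    | mem s hs =>
      obtain ⟨l, rfl⟩ := hs
      induction ha using Submodule.span_induction with
      | mem a ha =>
        obtain ⟨A, x, y, B, hb, rfl⟩ := ha
        exact Submodule.subset_span ⟨A, x, y, B ++ l, hb, by simp [γ, hW, mul_assoc]⟩
      | zero => simp
      | add a b _ _ ha hb => rw [add_mul]; exact Submodule.add_mem _ ha hb
      | smul c a _ ha => rw [smul_mul_assoc]; exact Submodule.smul_mem _ _ ha
    | zero => simp
    | add a b _ _ ha hb => rw [mul_add]; exact Submodule.add_mem _ ha hb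
    | smul c a _ ha => rw [mul_smul_comm]; exact Submodule.smul_mem _ _ ha
  let J : TwoSidedIdeal (TensorAlgebra F L) := TwoSidedIdeal.mk' K (Submodule.zero_mem _)
    (fun hx hy => Submodule.add_mem _ hx hy) (fun hx => Submodule.neg_mem _ hx)
    (fun {x y} hy => hKl x y hy) (fun {x y} hx => hKr y x hx)
  have hJ : G.envelopingIdeal ≤ J := by
    rw [envelopingIdeal, TwoSidedIdeal.span_le]
    rintro _ ⟨α, β, x, y, hx, hy, rfl⟩
    refine (TwoSidedIdeal.mem_mk' _ _ _ _ _ _ _).2 ?_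
    -- Any rank bound beyond length two will do, since `K` has no bound.
    have h1 := G.mul_relator_mul_mem b hd h2 [] [] hx hy (n := 3) (k := 0) (by simp)
    have h4 : G.relatorSpan b d (toLex (3, 0)) ≤ K :=
      Submodule.span_mono fun t ⟨A, x, y, B, hb, _, ht⟩ => ⟨A, x, y, B, hb, ht⟩
    have := h4 h1
    simpa [relator] using this
  let φ := Ideal.Quotient.mkₐ F G.envelopingIdeal.asIdeal
  have hφ : Function.Surjective φ := Ideal.Quotient.mkₐ_surjective F _
  have hφ0 : ∀ t, φ t = 0 ↔ t ∈ G.envelopingIdeal := fun t =>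
    Ideal.Quotient.eq_zero_iff_mem.trans TwoSidedIdeal.mem_asIdeal
  have hker : LinearMap.ker φ.toLinearMap = Submodule.span F (D '' reducibleWords ε d) := by
    apply le_antisymm
    · intro a ha
      exact hKD ((TwoSidedIdeal.mem_mk' _ _ _ _ _ _ _).1 (hJ ((hφ0 a).1 ha)))
    · refine Submodule.span_le.2 ?_
      rintro _ ⟨l, hl, rfl⟩
      obtain ⟨A, x, y, B, hb, -, ht⟩ := hred l hl
      rw [hD, ht]
      change φ (γ A x y B) = 0
      have : φ (G.basisRelator b d x y) = 0 := (hφ0 _).2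
        (TwoSidedIdeal.subset_span ⟨d x, d y, b x, b y, hd x, hd y, rfl⟩)
      simp [γ, this]
  obtain ⟨B, hB⟩ := exists_basis_of_ker_eq_span D _ φ.toLinearMap hφ hker
  refine ⟨B.reindex irreducibleWordsEquiv, fun n => ?_⟩
  rw [Module.Basis.reindex_apply, hB, hD, hirr _ (irreducibleWordsEquiv.symm n).2, hW,
    orderedProd_eq_wordProd]
  exact map_wordProd φ _ _

end LieColorAlgebra

/-! ### Jacobson's formula in an associative algebra -/

section Jacobson

open Polynomial

/-- Pascal's rule: neighbouring binomial coefficients of `p - 1` add up to one of `p`, which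
vanishes. -/
theorem choose_pred_prime {R : Type*} [Ring R] {p : ℕ} (hp : p.Prime) (h0 : (p : R) = 0) (m : ℕ)
    (hm : m < p) : ((p - 1).choose m : R) = (-1) ^ m := by
  induction m with
  | zero => simp
  | succ m ih =>
    have h1 := Nat.choose_succ_succ (p - 1) m
    rw [Nat.succ_eq_add_one, Nat.sub_add_cancel hp.one_le] at h1
    obtain ⟨k, hk⟩ := hp.dvd_choose_self (Nat.succ_ne_zero m) hm
    have h2 : ((p.choose (m + 1) : ℕ) : R) = 0 := by
      rw [Nat.succ_eq_add_one] at hk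
      rw [hk, Nat.cast_mul, h0, zero_mul]
    rw [h1, Nat.cast_add, ih (by omega)] at h2
    rw [pow_succ, mul_neg_one]
    exact (neg_eq_of_add_eq_zero_right h2).symm

theorem sub_pow_pred_prime {R : Type*} [Ring R] {p : ℕ} (hp : p.Prime) (hodd : Odd p)
    (h0 : (p : R) = 0) {x y : R} (h : Commute x y) :
    (x - y) ^ (p - 1) = ∑ k ∈ Finset.range p, x ^ k * y ^ (p - 1 - k) := by
  have heven : Even (p - 1) := by
    obtain ⟨r, hr⟩ := hodd
    exact ⟨r, by omega⟩
  rw [sub_eq_add_neg, h.neg_right.add_pow, Nat.sub_add_cancel hp.one_le]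
  refine Finset.sum_congr rfl fun k hk => ?_
  have hk' := Finset.mem_range.1 hk
  rw [choose_pred_prime hp h0 k hk', neg_pow y, mul_assoc, mul_assoc,
    ((Commute.neg_one_left (y ^ (p - 1 - k))).pow_left k).symm.eq, ← mul_assoc ((-1) ^ _) ((-1) ^ _),
    ← pow_add, Nat.sub_add_cancel (by omega : k ≤ p - 1), heven.neg_one_pow, one_mul]

theorem derivative_pow_eq_sum {A : Type*} [Ring A] (P : A[X]) (n : ℕ) :
    derivative (P ^ n) = ∑ k ∈ Finset.range n, P ^ k * derivative P * P ^ (n - 1 - k) := by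
  induction n with
  | zero => simp
  | succ n ih =>
    rw [pow_succ', derivative_mul, ih, Finset.sum_range_succ', Finset.mul_sum, add_comm]
    congr 1
    · refine Finset.sum_congr rfl fun k hk => ?_
      have : n + 1 - 1 - (k + 1) = n - 1 - k := by omega
      rw [this, pow_succ' P k]
      simp only [mul_assoc]
    · simp

variable {F A : Type*} [Field F] [Ring A] [Algebra F A]

/-- The commutator with `t a + c` on `A[t]`. -/
def commPoly (a c : A) (q : A[X]) : A[X] := (X * C a + C c) * q - q * (X * C a + C c)

/-- With `P = t a + c`, the commutator with `P` is the difference of the commuting operators of left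
and right multiplication. Its `(p-1)`-st power is the sum of the maps `q ↦ P^k q P^(p-1-k)`, and `a
= P'`, so the Leibniz rule yields the derivative of `P^p`. -/
theorem commPoly_iterate_eq_sum {p : ℕ} (hp : p.Prime) (hodd : Odd p) (h0 : (p : F) = 0)
    [CharP F p] (a c : A) :
    (commPoly a c)^[p - 1] (C a) = derivative ((X * C a + C c) ^ p) := by
  set P : A[X] := X * C a + C c
  have hP : derivative P = C a := by simp [P]
  have h0' : (p : Module.End F A[X]) = 0 := by
    rw [← map_natCast (algebraMap F (Module.End F A[X])), h0, map_zero]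
  have h1 := sub_pow_pred_prime hp hodd h0' (LinearMap.commute_mulLeft_right (R := F) P P)
  have h2 : commPoly a c = ⇑(LinearMap.mulLeft F P - LinearMap.mulRight F P) := by
    ext1 q
    simp [commPoly, P]
  rw [h2, ← Module.End.coe_pow, h1, derivative_pow_eq_sum, hP, LinearMap.sum_apply]
  refine Finset.sum_congr rfl fun k _ => ?_
  rw [Module.End.mul_apply, LinearMap.pow_mulLeft, LinearMap.pow_mulRight]
  simp [mul_assoc]

/-- Jacobson's formula for the `p`-th power of a sum. -/
theorem add_pow_eq_jacobson {p : ℕ} [CharP F p] (hp : p.Prime) (hodd : Odd p) (a c : A) :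
    (a + c) ^ p = a ^ p + c ^ p
      + ∑ i ∈ Finset.Icc 1 (p - 1),
        (i : F)⁻¹ • ((commPoly a c)^[p - 1] (C a)).coeff (i - 1) := by
  have h0 : (p : F) = 0 := CharP.cast_eq_zero F p
  rw [commPoly_iterate_eq_sum hp hodd h0]
  set P : A[X] := X * C a + C c with hPdef
  have hdeg : P.natDegree ≤ 1 := by
    rw [hPdef, X_mul_C]
    exact natDegree_linear_le
  have hdegp : (P ^ p).natDegree < p + 1 :=
    Nat.lt_succ_of_le ((natDegree_pow_le_of_le p hdeg).trans (by simp))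
  -- The sum of the coefficients of `P^p`. The outer two are `c^p` and `a^p`; the `i`-th one in
  -- between is recovered from the derivative, as `i` is invertible for `0 < i < p`.
  have h1 : (P ^ p).eval 1 = (a + c) ^ p := by
    have h : ∀ q : A[X], q.eval 1 = eval₂RingHom' (RingHom.id A) 1 (fun x => Commute.one_right x) q :=
      fun q => rfl
    rw [h, map_pow, ← h]
    simp [P]
  have hc0 : (P ^ p).coeff 0 = c ^ p := by
    rw [← constantCoeff_apply, map_pow]
    simp [P]
  have hcp : (P ^ p).coeff p = a ^ p := by
    have := coeff_pow_of_natDegree_le (m := p) hdeg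
    rw [mul_one] at this
    rw [this]
    simp [P, coeff_C]
  rw [← h1, eval_eq_sum_range' hdegp, Finset.sum_range_succ, ← Nat.Ico_zero_eq_range,
    Finset.sum_eq_sum_Ico_succ_bot hp.pos]
  simp only [one_pow, mul_one, hc0, hcp]
  have h2 : ∑ i ∈ Finset.Ico (0 + 1) p, (P ^ p).coeff i
      = ∑ i ∈ Finset.Icc 1 (p - 1), (i : F)⁻¹ • (derivative (P ^ p)).coeff (i - 1) := by
    refine Finset.sum_congr ?_ fun i hi => ?_
    · ext i
      simp only [Finset.mem_Ico, Finset.mem_Icc]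
      have := hp.pos
      omega
    · obtain ⟨hi1, hi2⟩ := Finset.mem_Ico.1 hi
      have hi0 : (i : F) ≠ 0 := by
        rw [Ne, CharP.cast_eq_zero_iff F p]
        exact Nat.not_dvd_of_pos_of_lt (by omega) (by omega)
      obtain ⟨j, rfl⟩ : ∃ j, i = j + 1 := ⟨i - 1, by omega⟩
      rw [Nat.add_sub_cancel, coeff_derivative]
      have h3 : (P ^ p).coeff (j + 1) * ((j : A) + 1)
          = ((j + 1 : ℕ) : F) • (P ^ p).coeff (j + 1) := by
        rw [Nat.cast_smul_eq_nsmul, nsmul_eq_mul, ← Nat.cast_succ, Nat.cast_comm]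
      rw [h3, smul_smul, inv_mul_cancel₀ hi0, one_smul]
  rw [h2]
  abel

end Jacobson

/-! ### The elements `x^p - x^[p]` -/

namespace LieColorAlgebra

variable {F Γ : Type*} [Field F] [AddCommGroup Γ] [DecidableEq Γ] {ε : Bicharacter F Γ}
  {L : Type*} [AddCommGroup L] [Module F L] (G : LieColorAlgebra ε L)
  {A : Type*} [Ring A] [Algebra F A]

/-- A linear map turns the color bracket into the color commutator. -/
def IsBracketHom (φ : L →ₗ[F] A) : Prop :=
  ∀ (α β : Γ) (x y : L), x ∈ G.deg α → y ∈ G.deg β →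
    φ (G.bracket x y) = φ x * φ y - ε.val α β • (φ y * φ x)

variable {G} {φ : L →ₗ[F] A} (hφ : G.IsBracketHom φ)
include hφ

/-- All coefficients lie in degrees that are multiples of `α`, where `(α, kα) = 1`, so the color
commutators are ordinary ones. Homogeneity is carried along to justify this. -/
theorem adPoly_coeff {α : Γ} (hα : ε.val α α = 1) {x y : L} (hx : x ∈ G.deg α)
    (hy : y ∈ G.deg α) (k i : ℕ) :
    ((G.adPoly x y)^[k] (PolynomialModule.single F 0 x)).coeff i ∈ G.deg ((k + 1) • α) ∧
    φ (((G.adPoly x y)^[k] (PolynomialModule.single F 0 x)).coeff i)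
      = ((commPoly (φ x) (φ y))^[k] (Polynomial.C (φ x))).coeff i := by
  have hε : ∀ k : ℕ, ε.val α (k • α) = 1 := by
    intro k
    induction k with
    | zero => simp
    | succ k ih => rw [succ_nsmul, ε.val_add_right, ih, hα, one_mul]
  induction k generalizing i with
  | zero =>
    rw [Function.iterate_zero, id, Function.iterate_zero, id, PolynomialModule.coeff_single,
      Polynomial.coeff_C, Finsupp.single_apply]
    by_cases h : i = 0
    · simp [h, hx]
    · simp [h, Ne.symm h]
  | succ k ih =>
    rw [Function.iterate_succ_apply', Function.iterate_succ_apply']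
    set m := (G.adPoly x y)^[k] (PolynomialModule.single F 0 x)
    set q := (commPoly (φ x) (φ y))^[k] (Polynomial.C (φ x))
    have hmap : ∀ (f : L →ₗ[F] L) (i : ℕ), (PolynomialModule.map F f m).coeff i = f (m.coeff i) :=
      fun f i => rfl
    have hb : ∀ v ∈ G.deg α, ∀ i, G.bracket v (m.coeff i) ∈ G.deg ((k + 1 + 1) • α) ∧
        φ (G.bracket v (m.coeff i)) = φ v * q.coeff i - q.coeff i * φ v := by
      intro v hv i
      refine ⟨?_, ?_⟩
      · rw [succ_nsmul' α (k + 1)]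
        exact G.bracket_mem _ _ _ _ hv (ih i).1
      · rw [hφ _ _ _ _ hv (ih i).1, (ih i).2, hε, one_smul]
    cases i with
    | zero =>
      have e1 : (G.adPoly x y m).coeff 0 = G.bracket y (m.coeff 0) := by
        simp [adPoly, hmap, ← Polynomial.monomial_one_one_eq_X]
      have e2 : (commPoly (φ x) (φ y) q).coeff 0 = φ y * q.coeff 0 - q.coeff 0 * φ y := by
        simp [commPoly]
      rw [e1, e2]
      exact hb y hy 0
    | succ i =>
      have e1 : (G.adPoly x y m).coeff (i + 1)
          = G.bracket x (m.coeff i) + G.bracket y (m.coeff (i + 1)) := by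
        simp [adPoly, hmap, ← Polynomial.monomial_one_one_eq_X]
      have e2 : (commPoly (φ x) (φ y) q).coeff (i + 1)
          = (φ x * q.coeff i - q.coeff i * φ x)
            + (φ y * q.coeff (i + 1) - q.coeff (i + 1) * φ y) := by
        rw [commPoly, add_mul, mul_add, Polynomial.coeff_sub, Polynomial.coeff_add,
          Polynomial.coeff_add, mul_assoc, Polynomial.coeff_X_mul, ← mul_assoc q,
          ← Polynomial.X_mul, mul_assoc, Polynomial.coeff_X_mul]
        simp only [Polynomial.coeff_C_mul, Polynomial.coeff_mul_C]
        abel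
      rw [e1, e2, φ.map_add, (hb x hx i).2, (hb y hy (i + 1)).2]
      exact ⟨Submodule.add_mem _ (hb x hx i).1 (hb y hy (i + 1)).1, rfl⟩

namespace Restricted

variable {p : ℕ} (R : G.Restricted p)

omit hφ in
variable (φ) in
/-- The element `φ x ^ p - φ (x^[p])`. -/
def pCentral (α : ε.Even) (x : G.deg α.1) : A := φ x ^ p - φ (R.pmap α x)

theorem pCentral_add [CharP F p] (hp : p.Prime) (hodd : Odd p) (α : ε.Even) (x y : G.deg α.1) :
    R.pCentral φ α (x + y) = R.pCentral φ α x + R.pCentral φ α y := by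
  have h1 := add_pow_eq_jacobson (F := F) hp hodd (φ x) (φ y)
  have h2 : ∀ i, φ (G.jacobsonTerm p i x y)
      = (i : F)⁻¹ • ((commPoly (φ x) (φ y))^[p - 1] (Polynomial.C (φ x))).coeff (i - 1) := by
    intro i
    rw [jacobsonTerm, map_smul, (adPoly_coeff hφ α.2 x.2 y.2 (p - 1) (i - 1)).2]
  rw [pCentral, R.pmap_add, Submodule.coe_add, map_add, h1, map_add, map_add, map_sum]
  simp only [h2, pCentral]
  abel

omit hφ in
theorem pCentral_smul (α : ε.Even) (r : F) (x : G.deg α.1) :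
    R.pCentral φ α (r • x) = r ^ p • R.pCentral φ α x := by
  rw [pCentral, R.pmap_smul, Submodule.coe_smul, map_smul, map_smul, smul_pow, ← smul_sub, pCentral]

/-- The map `φ` carries `[x, ·]` to `l - r`, with `l` left multiplication by `φ x` and `r` right
multiplication scaled by `c = (α,β)`; the scalar stays the same on iteration because `(α, kα + β) =
c`. These operators commute, so in characteristic `p` the `p`-th power is `l^p - r^p`, to be
compared with the action of `x^[p]`. -/
theorem pCentral_mul [CharP F p] (hp : p.Prime) (hodd : Odd p) (α : ε.Even) (x : G.deg α.1)
    {β : Γ} {y : L} (hy : y ∈ G.deg β) :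
    R.pCentral φ α x * φ y = ε.val (p • α.1) β • (φ y * R.pCentral φ α x) := by
  have hαα := α.2
  set c := ε.val α.1 β
  let l : Module.End F A := LinearMap.mulLeft F (φ x)
  let r : Module.End F A := c • LinearMap.mulRight F (φ x)
  have hcomm : Commute l r := (LinearMap.commute_mulLeft_right (R := F) (φ x) (φ x)).smul_right c
  have h0 : (p : Module.End F A) = 0 := by
    rw [← map_natCast (algebraMap F (Module.End F A)), CharP.cast_eq_zero F p, map_zero]
  have h1 : (l - r) ^ p = l ^ p - r ^ p := by
    obtain ⟨s, hs⟩ := hcomm.neg_right.exists_add_pow_prime_eq hp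
    rw [sub_eq_add_neg, hs, h0, hodd.neg_pow]
    simp [sub_eq_add_neg]
  have h2 : ∀ k, (G.bracket (x : L))^[k] y ∈ G.deg (k • α.1 + β) ∧
      ((l - r) ^ k) (φ y) = φ ((G.bracket (x : L))^[k] y) := by
    intro k
    induction k with
    | zero => simpa using hy
    | succ k ih =>
      have hk : ε.val α.1 (k • α.1 + β) = c := by
        have : ∀ k : ℕ, ε.val α.1 (k • α.1) = 1 := by
          intro k
          induction k with
          | zero => simp
          | succ k ih => rw [succ_nsmul, ε.val_add_right, ih, hαα, one_mul]
        rw [ε.val_add_right, this, one_mul]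
      rw [Function.iterate_succ_apply']
      refine ⟨?_, ?_⟩
      · have := G.bracket_mem _ _ _ _ x.2 ih.1
        rwa [← add_assoc, ← succ_nsmul'] at this
      · rw [pow_succ', Module.End.mul_apply, ih.2, hφ _ _ _ _ x.2 ih.1, hk]
        simp [l, r]
  have h3 := (h2 p).2
  have h4 : (l ^ p) (φ y) = φ x ^ p * φ y := by
    simp [l, LinearMap.pow_mulLeft]
  have h5 : (r ^ p) (φ y) = c ^ p • (φ y * φ x ^ p) := by
    simp [r, smul_pow, LinearMap.pow_mulRight]
  rw [h1, LinearMap.sub_apply, h4, h5, ← R.ad_pmap, hφ _ _ _ _ (R.pmap α x).2 hy,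
    ε.val_nsmul_left] at h3
  rw [pCentral, ε.val_nsmul_left, sub_mul, mul_sub, smul_sub]
  exact sub_eq_sub_iff_sub_eq_sub.1 h3

end Restricted

end LieColorAlgebra

/-! ### The induced grading and color-central elements -/

namespace LieColorAlgebra

variable {F Γ : Type*} [Field F] [AddCommGroup Γ] [DecidableEq Γ] {ε : Bicharacter F Γ}
  {L : Type*} [AddCommGroup L] [Module F L] (G : LieColorAlgebra ε L)

section Grading

variable {A : Type*} [Ring A] [Algebra F A] (φ : L →ₗ[F] A)

theorem one_mem_inducedGrading : (1 : A) ∈ G.inducedGrading φ 0 :=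
  Submodule.subset_span ⟨[], by simp, by simp⟩

theorem map_mem_inducedGrading {α : Γ} {x : L} (hx : x ∈ G.deg α) :
    φ x ∈ G.inducedGrading φ α :=
  Submodule.subset_span ⟨[⟨α, x, hx⟩], by simp, by simp⟩

theorem mul_mem_inducedGrading {α β : Γ} {a b : A} (ha : a ∈ G.inducedGrading φ α)
    (hb : b ∈ G.inducedGrading φ β) : a * b ∈ G.inducedGrading φ (α + β) := by
  induction ha using Submodule.span_induction with
  | mem a ha =>
    obtain ⟨l, rfl, rfl⟩ := ha
    induction hb using Submodule.span_induction with
    | mem b hb =>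
      obtain ⟨m, rfl, rfl⟩ := hb
      exact Submodule.subset_span ⟨l ++ m, by simp, by simp⟩
    | zero => simp
    | add a b _ _ ha hb => rw [mul_add]; exact Submodule.add_mem _ ha hb
    | smul c a _ ha => rw [mul_smul_comm]; exact Submodule.smul_mem _ _ ha
  | zero => simp
  | add a b _ _ ha hb => rw [add_mul]; exact Submodule.add_mem _ ha hb
  | smul c a _ ha => rw [smul_mul_assoc]; exact Submodule.smul_mem _ _ ha

instance gradedMonoid_inducedGrading : SetLike.GradedMonoid (G.inducedGrading φ) where
  one_mem := G.one_mem_inducedGrading φ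
  mul_mem _ _ _ _ ha hb := G.mul_mem_inducedGrading φ ha hb

theorem iSup_inducedGrading (h : TensorAlgebra F L →ₐ[F] A) (hs : Function.Surjective h)
    (hφ : ∀ x, h (TensorAlgebra.ι F x) = φ x) : ⨆ γ, G.inducedGrading φ γ = ⊤ := by
  rw [eq_top_iff]
  rintro a -
  obtain ⟨t, rfl⟩ := hs a
  induction t using TensorAlgebra.induction with
  | algebraMap r =>
    rw [AlgHom.commutes, Algebra.algebraMap_eq_smul_one]
    exact Submodule.smul_mem _ _
      (Submodule.mem_iSup_of_mem 0 (G.one_mem_inducedGrading φ))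
  | ι x =>
    rw [hφ]
    have hx : x ∈ ⨆ γ, G.deg γ := by rw [G.isInternal.submodule_iSup_eq_top]; trivial
    induction hx using Submodule.iSup_induction' with
    | mem γ x hx => exact Submodule.mem_iSup_of_mem γ (G.map_mem_inducedGrading φ hx)
    | zero => simp
    | add x y _ _ hx hy => rw [map_add]; exact Submodule.add_mem _ hx hy
  | mul a b ha hb =>
    rw [map_mul]
    generalize h a = a' at ha
    generalize h b = b' at hb
    induction ha using Submodule.iSup_induction' with
    | mem γ x hx =>
      induction hb using Submodule.iSup_induction' with
      | mem γ' y hy => exact Submodule.mem_iSup_of_mem _ (G.mul_mem_inducedGrading φ hx hy)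
      | zero => simp
      | add x y _ _ hx hy => rw [mul_add]; exact Submodule.add_mem _ hx hy
    | zero => simp
    | add x y _ _ hx hy => rw [add_mul]; exact Submodule.add_mem _ hx hy
  | add a b ha hb => rw [map_add]; exact Submodule.add_mem _ ha hb

/-- `w` is homogeneous of degree `τ` and commutes with all elements up to the bicharacter. -/
def IsColorCentral (τ : Γ) (w : A) : Prop :=
  w ∈ G.inducedGrading φ τ ∧
    ∀ γ, ∀ u ∈ G.inducedGrading φ γ, w * u = ε.val τ γ • (u * w)

variable {G φ}

theorem IsColorCentral.of_letters {τ : Γ} {w : A} (hw : w ∈ G.inducedGrading φ τ)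
    (h : ∀ β, ∀ y ∈ G.deg β, w * φ y = ε.val τ β • (φ y * w)) : G.IsColorCentral φ τ w := by
  refine ⟨hw, fun γ u hu => ?_⟩
  induction hu using Submodule.span_induction with
  | mem u hu =>
    obtain ⟨l, rfl, rfl⟩ := hu
    induction l with
    | nil => simp
    | cons y l ih =>
      simp only [List.map_cons, List.prod_cons, List.sum_cons]
      rw [← mul_assoc, h _ _ y.2.2, smul_mul_assoc, mul_assoc, ih, mul_smul_comm, smul_smul,
        ε.val_add_right, mul_assoc]
  | zero => simp
  | add a b _ _ ha hb => rw [mul_add, ha, hb, add_mul, smul_add]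
  | smul c a _ ha => rw [mul_smul_comm, ha, smul_mul_assoc, smul_comm]

theorem IsColorCentral.one : G.IsColorCentral φ 0 1 :=
  ⟨G.one_mem_inducedGrading φ, fun γ u _ => by simp⟩

theorem IsColorCentral.zero (τ : Γ) : G.IsColorCentral φ τ 0 :=
  ⟨Submodule.zero_mem _, fun γ u _ => by simp⟩

theorem IsColorCentral.sub {τ : Γ} {w w' : A} (h : G.IsColorCentral φ τ w)
    (h' : G.IsColorCentral φ τ w') : G.IsColorCentral φ τ (w - w') :=
  ⟨Submodule.sub_mem _ h.1 h'.1, fun γ u hu => by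
    rw [sub_mul, h.2 γ u hu, h'.2 γ u hu, mul_sub, smul_sub]⟩

theorem IsColorCentral.smul {τ : Γ} {w : A} (h : G.IsColorCentral φ τ w) (c : F) :
    G.IsColorCentral φ τ (c • w) :=
  ⟨Submodule.smul_mem _ _ h.1, fun γ u hu => by
    rw [smul_mul_assoc, h.2 γ u hu, mul_smul_comm, smul_comm]⟩

theorem IsColorCentral.mul {τ τ' : Γ} {w w' : A} (h : G.IsColorCentral φ τ w)
    (h' : G.IsColorCentral φ τ' w') : G.IsColorCentral φ (τ + τ') (w * w') :=
  ⟨G.mul_mem_inducedGrading φ h.1 h'.1, fun γ u hu => by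
    rw [mul_assoc, h'.2 γ u hu, mul_smul_comm, ← mul_assoc, h.2 γ u hu, smul_mul_assoc, smul_smul,
      ε.val_add_left, mul_comm (ε.val τ γ), mul_assoc]⟩

theorem IsColorCentral.pow {τ : Γ} {w : A} (h : G.IsColorCentral φ τ w) (k : ℕ) :
    G.IsColorCentral φ (k • τ) (w ^ k) := by
  induction k with
  | zero => simpa using IsColorCentral.one
  | succ k ih => rw [pow_succ, succ_nsmul]; exact ih.mul h

theorem Restricted.isColorCentral_pCentral {p : ℕ} [CharP F p] (hp : p.Prime) (hodd : Odd p)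
    (R : G.Restricted p) (hφ : G.IsBracketHom φ) (α : ε.Even) (x : G.deg α.1) :
    G.IsColorCentral φ (p • α.1) (R.pCentral φ α x) := by
  refine IsColorCentral.of_letters ?_ fun β y hy => R.pCentral_mul hφ hp hodd α x hy
  refine Submodule.sub_mem _ ?_ (G.map_mem_inducedGrading φ (R.pmap α x).2)
  exact SetLike.pow_mem_graded p (G.map_mem_inducedGrading φ x.2)

end Grading

/-! ### Universal properties -/

section Universal

variable {G} {A : Type*} [Ring A] [Algebra F A]

theorem exists_lift_enveloping {g : L →ₗ[F] A} (hg : G.IsBracketHom g) :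
    ∃ h : G.Enveloping →ₐ[F] A, ∀ x, h (G.envι x) = g x := by
  have hle : G.envelopingIdeal ≤ TwoSidedIdeal.ker (TensorAlgebra.lift F g) := by
    rw [envelopingIdeal, TwoSidedIdeal.span_le]
    rintro _ ⟨α, β, x, y, hx, hy, rfl⟩
    refine (TwoSidedIdeal.mem_ker _).2 ?_
    simp [hg α β x y hx hy]
  refine ⟨Ideal.Quotient.liftₐ _ (TensorAlgebra.lift F g) fun a ha =>
    (TwoSidedIdeal.mem_ker _).1 (hle (TwoSidedIdeal.mem_asIdeal.1 ha)), fun x => ?_⟩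
  exact TensorAlgebra.lift_ι_apply g x

theorem isBracketHom_envι : G.IsBracketHom G.envι := by
  intro α β x y hx hy
  have h : Ideal.Quotient.mkₐ F G.envelopingIdeal.asIdeal
      (TensorAlgebra.ι F x * TensorAlgebra.ι F y
      - ε.val α β • (TensorAlgebra.ι F y * TensorAlgebra.ι F x)
      - TensorAlgebra.ι F (G.bracket x y)) = 0 :=
    Ideal.Quotient.eq_zero_iff_mem.2 (TwoSidedIdeal.mem_asIdeal.2
      (TwoSidedIdeal.subset_span ⟨α, β, x, y, hx, hy, rfl⟩))
  rw [map_sub, map_sub, map_smul, map_mul, map_mul, sub_eq_zero] at h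
  exact h.symm

namespace PCharacter

variable {p : ℕ} (χ : G.PCharacter p) (R : G.Restricted p)

theorem map_eq_zero_of_mem_ideal {g : L →ₗ[F] A} (hχ : χ.Holds R g) (h : G.Enveloping →ₐ[F] A)
    (hh : ∀ x, h (G.envι x) = g x) {a : G.Enveloping} (ha : a ∈ χ.ideal R) : h a = 0 := by
  have hle : χ.ideal R ≤ TwoSidedIdeal.ker h := by
    rw [PCharacter.ideal, TwoSidedIdeal.span_le]
    rintro _ ((⟨α, l, x, hα, rfl⟩ | ⟨α, P, hα, rfl⟩) | ⟨α, P, x, hα, rfl⟩)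
    · refine (TwoSidedIdeal.mem_ker _).2 ?_
      rw [map_sub, map_sub, map_pow, hh, hh, hχ.1 α l hα x, AlgHom.commutes, sub_self]
    · refine (TwoSidedIdeal.mem_ker _).2 ?_
      rw [map_sub, map_pow, map_sub, map_pow, hh, hh, (hχ.2 α P hα).1, map_one, sub_self]
    · refine (TwoSidedIdeal.mem_ker _).2 ?_
      rw [map_sub, map_smul, map_sub, map_sub, map_pow, map_pow, hh, hh, hh, hh,
        (hχ.2 α P hα).2 x, sub_self]
  exact (TwoSidedIdeal.mem_ker _).1 (hle ha)

theorem exists_lift {g : L →ₗ[F] A} (hg : G.IsBracketHom g) (hχ : χ.Holds R g) :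
    ∃ h : χ.Reduced R →ₐ[F] A, ∀ x, h (χ.σ R x) = g x := by
  obtain ⟨h, hh⟩ := exists_lift_enveloping hg
  refine ⟨Ideal.Quotient.liftₐ _ h fun a ha =>
    χ.map_eq_zero_of_mem_ideal R hχ h hh (TwoSidedIdeal.mem_asIdeal.1 ha), fun x => hh x⟩

theorem isBracketHom_σ : G.IsBracketHom (χ.σ R) := by
  intro α β x y hx hy
  have h := congrArg (Ideal.Quotient.mkₐ F (χ.ideal R).asIdeal)
    (isBracketHom_envι (G := G) α β x y hx hy)
  rw [map_sub, map_smul, map_mul, map_mul] at h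
  exact h

theorem holds_σ : χ.Holds R (χ.σ R) := by
  have h0 : ∀ u ∈ χ.ideal R, Ideal.Quotient.mkₐ F (χ.ideal R).asIdeal u = 0 := fun u hu =>
    Ideal.Quotient.eq_zero_iff_mem.2 (TwoSidedIdeal.mem_asIdeal.2 hu)
  have hz : ∀ x y : L, Ideal.Quotient.mkₐ F (χ.ideal R).asIdeal (G.envι x ^ p - G.envι y)
      = χ.σ R x ^ p - χ.σ R y := fun x y => by
    rw [map_sub, map_pow]
    rfl
  refine ⟨fun α l hα x => ?_, fun α P hα => ⟨?_, fun x => ?_⟩⟩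
  · have := h0 _ (TwoSidedIdeal.subset_span (Or.inl (Or.inl ⟨α, l, x, hα, rfl⟩)))
    rw [map_sub, hz, AlgHom.commutes, sub_eq_zero] at this
    exact this
  · have := h0 _ (TwoSidedIdeal.subset_span (Or.inl (Or.inr ⟨α, P, hα, rfl⟩)))
    rw [map_sub, map_pow, hz, map_one, sub_eq_zero] at this
    exact this
  · have := h0 ((G.envι x ^ p - G.envι (R.pmap α x))
      - (P.c x) ^ p • (G.envι P.ξ ^ p - G.envι (R.pmap α P.ξ)))
      (TwoSidedIdeal.subset_span (Or.inr ⟨α, P, x, hα, rfl⟩))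
    rw [map_sub, map_smul, hz, hz, sub_eq_zero] at this
    exact this

/-- This makes the relation for a linear form homogeneous: a nonzero constant can occur only in
degree `pα = 0`. -/
theorem eq_zero_or_nsmul_eq_zero {α : ε.Even} {l : Module.Dual F (G.deg α.1)}
    (h : χ.toFun α = Sum.inl l) : l = 0 ∨ p • α.1 = 0 := by
  by_contra! hne
  by_cases h0 : addOrderOf α.1 = 0
  · have := χ.of_infinite α h0
    rw [h] at this
    exact hne.1 (Sum.inl_injective this)
  · have hfin : addOrderOf (p • α.1) ≠ 0 :=
      addOrderOf_ne_zero_iff.2 ((addOrderOf_ne_zero_iff.1 h0).nsmul)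
    rcases χ.of_finite α hne.2 hfin with h1 | ⟨q, h1⟩
    · rw [h] at h1
      exact hne.1 (Sum.inl_injective h1)
    · rw [h] at h1
      cases h1

theorem addOrderOf_pos {α : ε.Even} {q : G.DistClass p α.1} (h : χ.toFun α = Sum.inr q) :
    0 < addOrderOf (p • α.1) := by
  by_contra! h0
  have h1 : addOrderOf α.1 = 0 := by
    by_contra hne
    exact addOrderOf_ne_zero_iff.2 ((addOrderOf_ne_zero_iff.1 hne).nsmul) (Nat.le_zero.1 h0)
  have := χ.of_infinite α h1
  rw [h] at this
  cases this

/-! ### The coaction of the group algebra, and directness of the grading -/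

section Coaction

variable (φ : L →ₗ[F] A)

/-- The map `x ↦ φ x ⊗ [α]`, for `x` of degree `α`, into the group algebra of `Γ` over `A`. -/
def coactionLinear : L →ₗ[F] AddMonoidAlgebra A Γ :=
  DirectSum.toModule F Γ _ (fun γ => AddMonoidAlgebra.lsingle γ ∘ₗ φ ∘ₗ (G.deg γ).subtype) ∘ₗ
    (LinearEquiv.ofBijective (DirectSum.coeLinearMap G.deg) G.isInternal).symm.toLinearMap

theorem coactionLinear_of_mem {α : Γ} {x : L} (hx : x ∈ G.deg α) :
    coactionLinear (G := G) φ x = AddMonoidAlgebra.single α (φ x) := by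
  have h : (LinearEquiv.ofBijective (DirectSum.coeLinearMap G.deg) G.isInternal).symm x
      = DirectSum.lof F Γ (fun γ => G.deg γ) α ⟨x, hx⟩ := by
    rw [LinearEquiv.symm_apply_eq]
    exact (DirectSum.coeLinearMap_lof G.deg α ⟨x, hx⟩).symm
  simp only [coactionLinear, LinearMap.comp_apply, LinearEquiv.coe_coe, h, DirectSum.toModule_lof]
  rfl

omit [DecidableEq Γ] in
theorem single_sub_single (γ : Γ) (a b : A) : AddMonoidAlgebra.single γ a
    - AddMonoidAlgebra.single γ b = AddMonoidAlgebra.single γ (a - b) :=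
  (map_sub (AddMonoidAlgebra.lsingle (R := ℤ) γ) a b).symm

omit [DecidableEq Γ] in
theorem smul_single_eq (γ : Γ) (c : F) (b : A) : c • AddMonoidAlgebra.single γ b
    = AddMonoidAlgebra.single γ (c • b) :=
  (map_smul (AddMonoidAlgebra.lsingle (R := F) γ) c b).symm

variable {φ}

theorem isBracketHom_coactionLinear (hφ : G.IsBracketHom φ) :
    G.IsBracketHom (coactionLinear (G := G) φ) := by
  intro α β x y hx hy
  rw [coactionLinear_of_mem φ hx, coactionLinear_of_mem φ hy,
    coactionLinear_of_mem φ (G.bracket_mem _ _ _ _ hx hy), AddMonoidAlgebra.single_mul_single,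
    AddMonoidAlgebra.single_mul_single, add_comm β α, smul_single_eq, single_sub_single,
    hφ α β x y hx hy]

/-- The element `z(x)` is placed in degree `pα`. The constant in the first relation is zero or has
`pα = 0`, and `z(ξ)^s` lands in degree `s · pα = 0`, so all relations survive. -/
theorem holds_coactionLinear (hp : p.Prime) (hχ : χ.Holds R φ) :
    χ.Holds R (coactionLinear (G := G) φ) := by
  have hz : ∀ (α : ε.Even) (x : G.deg α.1),
      coactionLinear (G := G) φ x ^ p - coactionLinear (G := G) φ (R.pmap α x)
        = AddMonoidAlgebra.single (p • α.1) (φ x ^ p - φ (R.pmap α x)) := by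
    intro α x
    rw [coactionLinear_of_mem φ x.2, coactionLinear_of_mem φ (R.pmap α x).2,
      AddMonoidAlgebra.single_pow, single_sub_single]
  refine ⟨fun α l hα x => ?_, fun α P hα => ⟨?_, fun x => ?_⟩⟩
  · rw [hz, hχ.1 α l hα x, Algebra.algebraMap_eq_smul_one,
      Algebra.algebraMap_eq_smul_one, AddMonoidAlgebra.one_def, smul_single_eq]
    rcases χ.eq_zero_or_nsmul_eq_zero hα with rfl | h
    · simp [hp.ne_zero]
    · rw [h]
  · rw [hz, AddMonoidAlgebra.single_pow, (hχ.2 α P hα).1, addOrderOf_nsmul_eq_zero,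
      AddMonoidAlgebra.one_def]
  · rw [hz, hz, (hχ.2 α P hα).2 x, smul_single_eq]

theorem coaction_of_mem (Δ : A →ₐ[F] AddMonoidAlgebra A Γ)
    (hΔ : ∀ x, Δ (φ x) = coactionLinear (G := G) φ x) {γ : Γ} {b : A}
    (hb : b ∈ G.inducedGrading φ γ) : Δ b = AddMonoidAlgebra.single γ b := by
  induction hb using Submodule.span_induction with
  | mem b hb =>
    obtain ⟨l, rfl, rfl⟩ := hb
    induction l with
    | nil => simp [AddMonoidAlgebra.one_def]
    | cons y l ih =>
      simp only [List.map_cons, List.prod_cons, List.sum_cons]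
      rw [map_mul, ih, hΔ, coactionLinear_of_mem φ y.2.2, AddMonoidAlgebra.single_mul_single]
  | zero => simp
  | add a b _ _ ha hb =>
    rw [map_add, ha, hb]
    exact (map_add (AddMonoidAlgebra.lsingle (R := F) γ) a b).symm
  | smul c a _ ha => rw [map_smul, ha, smul_single_eq]

/-- Reading off the coefficient of `Δ` at `γ` is the identity on the piece of degree `γ` and zero on
all others. -/
theorem iSupIndep_inducedGrading (Δ : A →ₐ[F] AddMonoidAlgebra A Γ)
    (hΔ : ∀ x, Δ (φ x) = coactionLinear (G := G) φ x) : iSupIndep (G.inducedGrading φ) := by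
  rw [iSupIndep_def]
  intro γ
  let π : A →ₗ[F] A :=
    Finsupp.lapply γ ∘ₗ (AddMonoidAlgebra.coeffLinearEquiv F).toLinearMap ∘ₗ Δ.toLinearMap
  have hπ : ∀ β, ∀ b ∈ G.inducedGrading φ β, π b = if β = γ then b else 0 := by
    intro β b hb
    change (Δ b).coeff γ = _
    rw [coaction_of_mem Δ hΔ hb, AddMonoidAlgebra.coeff_single, Finsupp.single_apply]
  rw [Submodule.disjoint_def]
  intro b hb hb'
  have hle : ⨆ β, ⨆ (_ : β ≠ γ), G.inducedGrading φ β ≤ LinearMap.ker π :=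
    iSup_le fun β => iSup_le fun hβ b hb => by
      rw [LinearMap.mem_ker, hπ β b hb, if_neg hβ]
  have h1 := hπ γ b hb
  rw [if_pos rfl, LinearMap.mem_ker.1 (hle hb')] at h1
  exact h1.symm

end Coaction

/-- The projection of the tensor algebra onto the reduced enveloping algebra. -/
def tensorProj : TensorAlgebra F L →ₐ[F] χ.Reduced R :=
  (Ideal.Quotient.mkₐ F (χ.ideal R).asIdeal).comp (Ideal.Quotient.mkₐ F G.envelopingIdeal.asIdeal)

theorem tensorProj_surjective : Function.Surjective (χ.tensorProj R) :=
  (Ideal.Quotient.mkₐ_surjective F _).comp (Ideal.Quotient.mkₐ_surjective F _)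

theorem isGradedAlgebra (hp : p.Prime) : IsGradedAlgebra (G.inducedGrading (χ.σ R)) := by
  refine ⟨inferInstance, DirectSum.isInternal_submodule_of_iSupIndep_of_iSup_eq_top ?_
    (G.iSup_inducedGrading _ (χ.tensorProj R) (χ.tensorProj_surjective R) fun x => rfl)⟩
  -- The target here is the ungraded lifting property, so no circularity arises.
  obtain ⟨Δ, hΔ⟩ := χ.exists_lift R (isBracketHom_coactionLinear (χ.isBracketHom_σ R))
    (χ.holds_coactionLinear R hp (χ.holds_σ R))
  exact iSupIndep_inducedGrading Δ hΔ

theorem isReducedEnveloping.{v} (hp : p.Prime) :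
    PCharacter.IsReducedEnveloping.{v} χ R (G.inducedGrading (χ.σ R)) (χ.σ R) := by
  refine ⟨χ.isGradedAlgebra R hp, ⟨fun α x hx => G.map_mem_inducedGrading _ hx,
    χ.isBracketHom_σ R⟩, χ.holds_σ R, fun A _ _ 𝒜 h𝒜 g hg hχ => ?_⟩
  obtain ⟨h, hh⟩ := χ.exists_lift R hg.2 hχ
  have := h𝒜.1
  refine ⟨h, ⟨fun γ b hb => ?_, hh⟩, fun h' hh' => ?_⟩
  · induction hb using Submodule.span_induction with
    | mem b hb =>
      obtain ⟨l, rfl, rfl⟩ := hb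
      induction l with
      | nil => simpa using SetLike.GradedOne.one_mem (A := 𝒜)
      | cons y l ih =>
        simp only [List.map_cons, List.prod_cons, List.sum_cons]
        rw [map_mul, hh]
        exact SetLike.GradedMul.mul_mem (hg.1 _ _ y.2.2) ih
    | zero => simp
    | add a b _ _ ha hb => rw [map_add]; exact Submodule.add_mem _ ha hb
    | smul c a _ ha => rw [map_smul]; exact Submodule.smul_mem _ _ ha
  · have hcomp : h'.comp (χ.tensorProj R) = h.comp (χ.tensorProj R) := by
      refine TensorAlgebra.hom_ext (LinearMap.ext fun x => ?_)
      exact (hh'.2 x).trans (hh x).symm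
    ext b
    obtain ⟨t, rfl⟩ := χ.tensorProj_surjective R b
    exact DFunLike.congr_fun hcomp t

end PCharacter

end Universal

end LieColorAlgebra

/-! ### Reduction of the relations to basis elements and fixed representatives -/

namespace LieColorAlgebra

variable {F Γ : Type*} [Field F] [AddCommGroup Γ] [DecidableEq Γ] {ε : Bicharacter F Γ}
  {L : Type*} [AddCommGroup L] [Module F L] {G : LieColorAlgebra ε L}

theorem eq_of_mem_deg {α β : Γ} {x : L} (hα : x ∈ G.deg α) (hβ : x ∈ G.deg β) (hx : x ≠ 0) :
    α = β := by
  by_contra hne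
  have h1 := G.degProj_of_mem (γ := β) hα
  rw [G.degProj_of_mem hβ, if_pos rfl, if_neg hne] at h1
  exact hx h1

section Holds

variable {X A : Type*} [Ring A] [Algebra F A] (b : Module.Basis X F L) {d : X → Γ}
  (hd : ∀ x, b x ∈ G.deg (d x)) {p : ℕ}
include hd

/-- Two `p`-semilinear maps on a component agree if they agree on its basis elements. -/
theorem semilinear_ext {α : Γ} {D E : G.deg α → A}
    (hD : ∀ x y, D (x + y) = D x + D y) (hD' : ∀ (r : F) x, D (r • x) = r ^ p • D x)
    (hE : ∀ x y, E (x + y) = E x + E y) (hE' : ∀ (r : F) x, E (r • x) = r ^ p • E x)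
    (h : ∀ x (hx : d x = α), D ⟨b x, hx ▸ hd x⟩ = E ⟨b x, hx ▸ hd x⟩) (v : G.deg α) :
    D v = E v := by
  have hle : Submodule.span F (b '' {x | d x = α}) ≤ G.deg α := by
    refine Submodule.span_le.2 ?_
    rintro _ ⟨x, rfl, rfl⟩
    exact hd x
  have key : ∀ (v : L) (hv : v ∈ Submodule.span F (b '' {x | d x = α})),
      D ⟨v, hle hv⟩ = E ⟨v, hle hv⟩ := by
    intro v hv
    induction hv using Submodule.span_induction with
    | mem v hv =>
      obtain ⟨x, hx, rfl⟩ := hv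
      exact h x hx
    | zero =>
      have h1 := hD 0 0
      have h2 := hE 0 0
      rw [add_zero, left_eq_add] at h1 h2
      exact h1.trans h2.symm
    | add v w hv hw h1 h2 =>
      have h3 := hD ⟨v, hle hv⟩ ⟨w, hle hw⟩
      rw [h1, h2, ← hE] at h3
      exact h3
    | smul c v hv h1 =>
      have h3 := hD' c ⟨v, hle hv⟩
      rw [h1, ← hE'] at h3
      exact h3
  exact key v (G.deg_le_span b hd α v.2)

variable [CharP F p] (hp : p.Prime) (hodd : Odd p) {R : G.Restricted p} {χ : G.PCharacter p}
  (rep : (α : χ.ClassDegree) → G.DistPair α.1.1)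
  (hrep : ∀ α : χ.ClassDegree, χ.toFun α.1 = Sum.inr ((rep α).mk' p))
include hp hodd hrep

/-- The relations of a `p`-character follow from those for basis elements and fixed
representatives. -/
theorem PCharacter.holds_of_basis {g : L →ₗ[F] A} (hg : G.IsBracketHom g)
    (h1 : ∀ x (h : ε.val (d x) (d x) = 1) l, χ.toFun ⟨d x, h⟩ = Sum.inl l →
      R.pCentral g ⟨d x, h⟩ ⟨b x, hd x⟩ = algebraMap F A (l ⟨b x, hd x⟩ ^ p))
    (h2 : ∀ x (h : ε.val (d x) (d x) = 1) (hq : ∃ q, χ.toFun ⟨d x, h⟩ = Sum.inr q),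
      R.pCentral g ⟨d x, h⟩ ⟨b x, hd x⟩ = (rep ⟨⟨d x, h⟩, hq⟩).c ⟨b x, hd x⟩ ^ p •
        R.pCentral g ⟨d x, h⟩ (rep ⟨⟨d x, h⟩, hq⟩).ξ)
    (h3 : ∀ α : χ.ClassDegree,
      R.pCentral g α.1 (rep α).ξ ^ addOrderOf (p • α.1.1) = 1) : χ.Holds R g := by
  have : Fact p.Prime := ⟨hp⟩
  have h1' : ∀ (α : ε.Even) l, χ.toFun α = Sum.inl l → ∀ y (hy : d y = α.1),
      R.pCentral g α ⟨b y, hy ▸ hd y⟩ = algebraMap F A (l ⟨b y, hy ▸ hd y⟩ ^ p) := by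
    rintro ⟨α, hα⟩ l hl y hy
    change d y = α at hy
    subst hy
    exact h1 y hα l hl
  have h2' : ∀ (α : ε.Even) (hq : ∃ q, χ.toFun α = Sum.inr q) y (hy : d y = α.1),
      R.pCentral g α ⟨b y, hy ▸ hd y⟩ = (rep ⟨α, hq⟩).c ⟨b y, hy ▸ hd y⟩ ^ p •
        R.pCentral g α (rep ⟨α, hq⟩).ξ := by
    rintro ⟨α, hα⟩ hq y hy
    change d y = α at hy
    subst hy
    exact h2 y hα hq
  refine ⟨fun α l hα x => ?_, fun α P hα => ?_⟩
  · refine semilinear_ext b hd (p := p) (D := R.pCentral g α)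
      (E := fun x => algebraMap F A (l x ^ p)) (R.pCentral_add hg hp hodd α)
      (R.pCentral_smul α) (fun x y => ?_) (fun r x => ?_) ?_ x
    · rw [map_add, add_pow_char, map_add]
    · rw [map_smul, smul_eq_mul, mul_pow, map_mul, Algebra.smul_def]
    · exact fun y hy => h1' α l hα y hy
  · let a : χ.ClassDegree := ⟨α, _, hα⟩
    let Q := rep a
    have hQ : ∀ x : G.deg α.1, R.pCentral g α x = Q.c x ^ p • R.pCentral g α Q.ξ := by
      refine semilinear_ext b hd (p := p) (D := R.pCentral g α)
        (E := fun x => Q.c x ^ p • R.pCentral g α Q.ξ) (R.pCentral_add hg hp hodd α)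
        (R.pCentral_smul α) (fun x y => ?_) (fun r x => ?_)
        (fun y hy => h2' α ⟨_, hα⟩ y hy)
      · rw [map_add, add_pow_char, add_smul]
      · rw [map_smul, smul_eq_mul, mul_pow, mul_smul]
    -- Passing to another representative rescales by an `s`-th root of unity, whose `p`-th power
    -- disappears from the `s`-th power of `z(ξ)`.
    have hrel : Q.c = Q.c P.ξ • P.c ∧ P.c = P.c Q.ξ • Q.c ∧
        Q.c P.ξ ^ addOrderOf (p • α.1) = 1 ∧ P.c Q.ξ ^ addOrderOf (p • α.1) = 1 := by
      have h4 := (hrep a).symm.trans hα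
      exact Quotient.exact (s := G.distSetoid p α.1) (Sum.inr_injective h4)
    have hz3 := h3 a
    refine ⟨?_, fun x => ?_⟩
    · change R.pCentral g α P.ξ ^ addOrderOf (p • α.1) = 1
      rw [hQ P.ξ, smul_pow, ← pow_mul, mul_comm p, pow_mul, hrel.2.2.1, one_pow, one_smul]
      exact hz3
    · change R.pCentral g α x = P.c x ^ p • R.pCentral g α P.ξ
      rw [hQ x, hQ P.ξ, smul_smul, ← mul_pow]
      congr 2
      exact (LinearMap.congr_fun hrel.1 x).trans (mul_comm _ _)

end Holds

end LieColorAlgebra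

/-! ### One relator for each basis element, and the basis of the reduced algebra -/

namespace LieColorAlgebra

open Classical in
/-- The exponent bound of a basis element `e`: `2` for odd `e`, `p` times the order of `pα` for a
distinguished `e` of degree `α`, and `p` otherwise. -/
def exponentBound {F Γ X : Type*} [Field F] [AddCommGroup Γ] (ε : Bicharacter F Γ) (d : X → Γ)
    (p : ℕ) (Dist : X → Prop) (x : X) : ℕ :=
  if ε.val (d x) (d x) = 1 then if Dist x then p * addOrderOf (p • d x) else p else 2

open Classical in
/-- The weight `2` for distinguished and `3` for other basis elements. -/
def distWeight {X : Type*} (Dist : X → Prop) (x : X) : ℕ := if Dist x then 2 else 3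

variable {F Γ : Type*} [Field F] [AddCommGroup Γ] [DecidableEq Γ] {ε : Bicharacter F Γ}
  {L : Type*} [AddCommGroup L] [Module F L] {G : LieColorAlgebra ε L}
  {X : Type*} (b : Module.Basis X F L) {d : X → Γ}
  (hd : ∀ x, b x ∈ G.deg (d x))

section Weight

variable (Dist : X → Prop)

theorem two_le_distWeight (x : X) : 2 ≤ distWeight Dist x := by
  unfold distWeight
  split_ifs <;> omega

/-- One letter weighs at most `3`, two letters at least `4`: hence the bracket is always a lower
term. -/
theorem envι_mem_lowerWeight (v : L) {m : ℕ} (hm : 4 ≤ m) :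
    G.envι v ∈ lowerWeight F (fun x => G.envι (b x)) (distWeight Dist) m := by
  have hv : v ∈ Submodule.span F (Set.range b) := by rw [b.span_eq]; trivial
  induction hv using Submodule.span_induction with
  | mem v hv =>
    obtain ⟨x, rfl⟩ := hv
    refine Submodule.subset_span ⟨[x], ?_, by simp⟩
    have : distWeight Dist x ≤ 3 := by
      unfold distWeight
      split_ifs <;> omega
    simp
    omega
  | zero => simp
  | add v w _ _ hv hw => rw [map_add]; exact Submodule.add_mem _ hv hw
  | smul c v _ hv => rw [map_smul]; exact Submodule.smul_mem _ _ hv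

include hd

theorem envι_comm_mem_lowerWeight (x y : X) : ∃ c : F, c ≠ 0 ∧
    G.envι (b x) * G.envι (b y) - c • (G.envι (b y) * G.envι (b x))
      ∈ lowerWeight F (fun x => G.envι (b x)) (distWeight Dist)
        (distWeight Dist x + distWeight Dist y) := by
  refine ⟨ε.val (d x) (d y), ε.val_ne_zero _ _, ?_⟩
  rw [← isBracketHom_envι _ _ _ _ (hd x) (hd y)]
  have h1 := two_le_distWeight Dist x
  have h2 := two_le_distWeight Dist y
  exact envι_mem_lowerWeight b Dist _ (by omega)

theorem envι_sq_mem_lowerWeight (h2 : (2 : F) ≠ 0) (x : X) (hx : ε.val (d x) (d x) = -1) :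
    G.envι (b x) * G.envι (b x) ∈ lowerWeight F (fun x => G.envι (b x)) (distWeight Dist)
        (distWeight Dist x + distWeight Dist x) := by
  have h := isBracketHom_envι _ _ _ _ (hd x) (hd x)
  rw [hx, neg_one_smul, sub_neg_eq_add, ← two_smul F] at h
  have h1 := two_le_distWeight Dist x
  have h3 := envι_mem_lowerWeight (G := G) b Dist (G.bracket (b x) (b x))
    (m := distWeight Dist x + distWeight Dist x) (by omega)
  rw [h] at h3
  exact (Submodule.smul_mem_iff _ h2).1 h3

omit hd in
theorem hasLead_pCentral [LinearOrder X] {p : ℕ} (hp3 : 3 < p) (R : G.Restricted p) (x : X) (α : ε.Even)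
    (v : G.deg α.1) (hv : b x = v) :
    HasLead F (fun x => G.envι (b x)) (distWeight Dist) (R.pCentral G.envι α v)
      (Finsupp.single x p) := by
  have h1 := two_le_distWeight Dist x
  refine HasLead.sub_lower ⟨1, one_ne_zero, ?_⟩ (envι_mem_lowerWeight b Dist _ ?_)
  · simp [hv]
  · rw [Finsupp.weight_single, smul_eq_mul]
    nlinarith

end Weight

section Comp

variable {A B : Type*} [Ring A] [Ring B] [Algebra F A] [Algebra F B]

theorem IsBracketHom.comp {g : L →ₗ[F] A} (hg : G.IsBracketHom g) (h : A →ₐ[F] B) :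
    G.IsBracketHom (h.toLinearMap ∘ₗ g) := by
  intro α β x y hx hy
  simp [hg α β x y hx hy]

theorem Restricted.map_pCentral {p : ℕ} (R : G.Restricted p) (g : L →ₗ[F] A) (h : A →ₐ[F] B)
    (α : ε.Even) (x : G.deg α.1) :
    h (R.pCentral g α x) = R.pCentral (h.toLinearMap ∘ₗ g) α x := by
  simp [Restricted.pCentral]

end Comp

section Relators

variable [LinearOrder X] {p : ℕ} [CharP F p] (hp : p.Prime) (hp3 : 3 < p) {R : G.Restricted p}
  {χ : G.PCharacter p} (rep : (α : χ.ClassDegree) → G.DistPair α.1.1)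
  (hrep : ∀ α : χ.ClassDegree, χ.toFun α.1 = Sum.inr ((rep α).mk' p))
  (hcontain : ∀ α : χ.ClassDegree, ∃ x, b x = (rep α).ξ)

/-- `e` is the first component of a chosen representative. -/
def IsDistinguished (x : X) : Prop := ∃ α : χ.ClassDegree, b x = (rep α).ξ

include hd hp hp3 hrep hcontain

/-- The hypotheses of `exists_basis_quotient`, letter by letter. The last clauses record the
explicit form of `w`, from which the relations of `χ` are recovered in the quotient by the `w`. -/
theorem exists_relator (x : X) : ∃ (w : G.Enveloping) (τ : Γ), G.IsColorCentral G.envι τ w ∧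
    (ε.val (d x) (d x) = -1 → w = 0) ∧
    (ε.val (d x) (d x) ≠ -1 → HasLead F (fun x => G.envι (b x))
      (distWeight (IsDistinguished b rep)) w
      (Finsupp.single x (exponentBound ε d p (IsDistinguished b rep) x))) ∧
    w ∈ χ.ideal R ∧
    (∀ (h : ε.val (d x) (d x) = 1) l, χ.toFun ⟨d x, h⟩ = Sum.inl l →
      w = R.pCentral G.envι ⟨d x, h⟩ ⟨b x, hd x⟩
        - algebraMap F G.Enveloping (l ⟨b x, hd x⟩ ^ p)) ∧
    (∀ (h : ε.val (d x) (d x) = 1) (hq : ∃ q, χ.toFun ⟨d x, h⟩ = Sum.inr q),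
      (b x ≠ (rep ⟨⟨d x, h⟩, hq⟩).ξ →
        w = R.pCentral G.envι ⟨d x, h⟩ ⟨b x, hd x⟩ - (rep ⟨⟨d x, h⟩, hq⟩).c ⟨b x, hd x⟩ ^ p •
          R.pCentral G.envι ⟨d x, h⟩ (rep ⟨⟨d x, h⟩, hq⟩).ξ) ∧
      (b x = (rep ⟨⟨d x, h⟩, hq⟩).ξ →
        w = R.pCentral G.envι ⟨d x, h⟩ (rep ⟨⟨d x, h⟩, hq⟩).ξ ^ addOrderOf (p • d x) - 1)) := by
  classical
  have hodd : Odd p := hp.odd_of_ne_two (by omega)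
  have h2 : (2 : F) ≠ 0 := by
    have : ((2 : ℕ) : F) ≠ 0 := by
      rw [Ne, CharP.cast_eq_zero_iff F p]
      exact Nat.not_dvd_of_pos_of_lt (by omega) (by omega)
    exact_mod_cast this
  have hneg : (1 : F) ≠ -1 := fun h => h2 (by linear_combination h)
  rcases ε.val_self (d x) with hx | hx
  swap
  · refine ⟨0, 0, IsColorCentral.zero 0, fun _ => rfl, fun h => absurd hx h, TwoSidedIdeal.zero_mem _,
      fun h => ?_, fun h => ?_⟩
    · exact absurd (h.symm.trans hx) hneg
    · exact absurd (h.symm.trans hx) hneg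
  set Dist := IsDistinguished b rep with hDist
  let α : ε.Even := ⟨d x, hx⟩
  let v : G.deg α.1 := ⟨b x, hd x⟩
  have hcentral : ∀ v, G.IsColorCentral G.envι (p • α.1) (R.pCentral G.envι α v) :=
    R.isColorCentral_pCentral hp hodd isBracketHom_envι α
  have hwt := two_le_distWeight Dist x
  rcases hχ : χ.toFun α with l | q
  · have hnd : ¬ Dist x := by
      rintro ⟨β, hβ⟩
      -- A nonzero vector has only one degree, so a distinguished letter of degree `α` would make
      -- `χ_α` a class.
      have h1 : β.1.1 = d x := eq_of_mem_deg (hβ ▸ (rep β).ξ.2) (hd x) (b.ne_zero x)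
      have h3 : β.1 = α := Subtype.ext h1
      have h4 : ∃ q, χ.toFun α = Sum.inr q := h3 ▸ β.2
      obtain ⟨q, hq⟩ := h4
      have := hχ.symm.trans hq
      cases this
    have hbound : exponentBound ε d p Dist x = p := by simp [exponentBound, hx, hnd]
    refine ⟨R.pCentral G.envι α v - algebraMap F G.Enveloping (l v ^ p), p • α.1, ?_,
      fun h => absurd (hx.symm.trans h) hneg, fun _ => ?_, ?_, fun h l' hl' => ?_, fun h hq => ?_⟩
    · refine (hcentral v).sub ?_
      rw [Algebra.algebraMap_eq_smul_one]
      rcases χ.eq_zero_or_nsmul_eq_zero hχ with rfl | h0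
      · simpa [hp.ne_zero] using IsColorCentral.zero (p • α.1)
      · rw [h0]
        exact IsColorCentral.one.smul _
    · rw [hbound]
      refine (hasLead_pCentral b Dist hp3 R x α v rfl).sub_lower ?_
      rw [Algebra.algebraMap_eq_smul_one]
      refine Submodule.smul_mem _ _ (wordProd_mem_lowerWeight (l := []) ?_)
      rw [Finsupp.weight_single, smul_eq_mul, List.map_nil, List.sum_nil]
      exact Nat.mul_pos (by omega) (by omega)
    · exact TwoSidedIdeal.subset_span (Or.inl (Or.inl ⟨α, l, v, hχ, rfl⟩))
    · have := hχ.symm.trans hl'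
      rw [Sum.inl_injective this]
    · obtain ⟨q, hq⟩ := hq
      have := hχ.symm.trans hq
      cases this
  · let a : χ.ClassDegree := ⟨α, q, hχ⟩
    have hs : 0 < addOrderOf (p • d x) := χ.addOrderOf_pos hχ
    by_cases hξ : b x = (rep a).ξ
    · have hdist : Dist x := ⟨a, hξ⟩
      have hbound : exponentBound ε d p Dist x = p * addOrderOf (p • d x) := by
        simp [exponentBound, hx, hdist]
      refine ⟨R.pCentral G.envι α (rep a).ξ ^ addOrderOf (p • d x) - 1, 0, ?_,
        fun h => absurd (hx.symm.trans h) hneg, fun _ => ?_, ?_, fun h l' hl' => ?_,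
        fun h hq => ⟨fun hne => absurd hξ hne, fun _ => rfl⟩⟩
      · have h1 := (hcentral (rep a).ξ).pow (addOrderOf (p • d x))
        have h3 : addOrderOf (p • d x) • p • α.1 = 0 := addOrderOf_nsmul_eq_zero _
        rw [h3] at h1
        exact h1.sub IsColorCentral.one
      · have h1 := (hasLead_pCentral b Dist hp3 R x α (rep a).ξ hξ).pow
          (envι_comm_mem_lowerWeight b hd Dist) (addOrderOf (p • d x))
        rw [Finsupp.smul_single, smul_eq_mul, mul_comm] at h1
        rw [hbound]
        refine h1.sub_lower (wordProd_mem_lowerWeight (l := []) ?_)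
        rw [Finsupp.weight_single, smul_eq_mul, List.map_nil, List.sum_nil]
        exact Nat.mul_pos (Nat.mul_pos (by omega) hs) (by omega)
      · exact TwoSidedIdeal.subset_span (Or.inl (Or.inr ⟨α, rep a, hrep a, rfl⟩))
      · have := hχ.symm.trans hl'
        cases this
    · have hnd : ¬ Dist x := by
        rintro ⟨β, hβ⟩
        have h1 : β.1.1 = d x := eq_of_mem_deg (hβ ▸ (rep β).ξ.2) (hd x) (b.ne_zero x)
        have h3 : β = a := Subtype.ext (Subtype.ext h1)
        subst h3
        exact hξ hβ
      have hbound : exponentBound ε d p Dist x = p := by simp [exponentBound, hx, hnd]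
      refine ⟨R.pCentral G.envι α v - (rep a).c v ^ p • R.pCentral G.envι α (rep a).ξ, p • α.1,
        (hcentral v).sub ((hcentral _).smul _),
        fun h => absurd (hx.symm.trans h) hneg, fun _ => ?_, ?_, fun h l' hl' => ?_,
        fun h hq => ⟨fun _ => rfl, fun he => absurd he hξ⟩⟩
      · rw [hbound]
        refine (hasLead_pCentral b Dist hp3 R x α v rfl).sub_lower (Submodule.smul_mem _ _ ?_)
        -- This is what the two weights are for: `ξ^p` weighs `2p`, less than the `3p` of `x^p`,
        -- although both have the same length.
        have hx3 : distWeight Dist x = 3 := by simp [distWeight, hnd]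
        rw [Finsupp.weight_single, smul_eq_mul, hx3]
        obtain ⟨y, hy⟩ := hcontain a
        have hy2 : distWeight Dist y = 2 := by
          have : Dist y := ⟨a, hy⟩
          simp [distWeight, this]
        refine Submodule.sub_mem _ ?_ (envι_mem_lowerWeight b Dist _ (by omega))
        have h3 := wordProd_mem_lowerWeight (F := F) (u := fun x => G.envι (b x))
          (wt := distWeight Dist) (l := List.replicate p y) (m := p * 3)
          (by simp [hy2]; omega)
        simpa [wordProd, hy] using h3
      · exact TwoSidedIdeal.subset_span (Or.inr ⟨α, rep a, v, hrep a, rfl⟩)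
      · have := hχ.symm.trans hl'
        cases this

/-- The basis of the reduced enveloping algebra attached to an ordered homogeneous basis. -/
theorem exists_reduced_basis :
    ∃ B : Module.Basis
        {n : X →₀ ℕ // ∀ x, n x < exponentBound ε d p (IsDistinguished b rep) x} F (χ.Reduced R),
      ∀ n, B n = orderedProd (fun x => χ.σ R (b x)) n.1 := by
  have hodd : Odd p := hp.odd_of_ne_two (by omega)
  have hcast : ∀ k : ℕ, 0 < k → k < p → (k : F) ≠ 0 := fun k h0 h1 => by
    rw [Ne, CharP.cast_eq_zero_iff F p]
    exact Nat.not_dvd_of_pos_of_lt h0 h1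
  have h2 : (2 : F) ≠ 0 := by exact_mod_cast hcast 2 (by omega) (by omega)
  have h3 : (3 : F) ≠ 0 := by exact_mod_cast hcast 3 (by omega) (by omega)
  have hneg : (1 : F) ≠ -1 := fun h => h2 (by linear_combination h)
  obtain ⟨B, hB⟩ := G.exists_pbw_basis b hd h2 h3
  choose w τ hwc hw0 hlead hwI hwl hwq using
    exists_relator (R := R) b hd hp hp3 rep hrep hcontain
  set Dist := IsDistinguished b rep
  have hcomm : ∀ x y : X, w x * G.envι (b y) = ε.val (τ x) (d y) • (G.envι (b y) * w x) :=
    fun x y => (hwc x).2 _ _ (G.map_mem_inducedGrading _ (hd y))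
  have hJI : TwoSidedIdeal.span (Set.range w) ≤ χ.ideal R := by
    rw [TwoSidedIdeal.span_le]
    rintro _ ⟨x, rfl⟩
    exact hwI x
  -- In the quotient by the `w x` the relations hold for basis elements and chosen representatives,
  -- hence for all elements and representatives by semilinearity; so `I_χ` maps to zero there.
  have hIJ : ∀ a ∈ χ.ideal R, a ∈ TwoSidedIdeal.span (Set.range w) := by
    set J := TwoSidedIdeal.span (Set.range w)
    let π := Ideal.Quotient.mkₐ F J.asIdeal
    have hπ : ∀ a, π a = 0 ↔ a ∈ J := fun a =>
      Ideal.Quotient.eq_zero_iff_mem.trans TwoSidedIdeal.mem_asIdeal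
    have hw : ∀ x, π (w x) = 0 := fun x => (hπ _).2 (TwoSidedIdeal.subset_span ⟨x, rfl⟩)
    have hχ : χ.Holds R (π.toLinearMap ∘ₗ G.envι) := by
      refine PCharacter.holds_of_basis b hd hp hodd rep hrep (isBracketHom_envι.comp π)
        (fun x h l hl => ?_) (fun x h hq => ?_) (fun α => ?_)
      · have h4 := hw x
        rw [hwl x h l hl, map_sub, R.map_pCentral, AlgHom.commutes, sub_eq_zero] at h4
        exact h4
      · by_cases hx : b x = (rep ⟨⟨d x, h⟩, hq⟩).ξ
        · have h4 : (⟨b x, hd x⟩ : G.deg (d x)) = (rep ⟨⟨d x, h⟩, hq⟩).ξ := Subtype.ext hx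
          rw [h4, (rep ⟨⟨d x, h⟩, hq⟩).c_ξ, one_pow, one_smul]
        · have h4 := hw x
          rw [(hwq x h hq).1 hx, map_sub, map_smul, R.map_pCentral, R.map_pCentral,
            sub_eq_zero] at h4
          exact h4
      · obtain ⟨x, hx⟩ := hcontain α
        obtain ⟨⟨α, hα⟩, hq⟩ := α
        have h1 : d x = α := eq_of_mem_deg (hd x) (hx ▸ (rep ⟨⟨α, hα⟩, hq⟩).ξ.2) (b.ne_zero x)
        subst h1
        have h4 := hw x
        rw [(hwq x hα hq).2 hx, map_sub, map_pow, R.map_pCentral, map_one, sub_eq_zero] at h4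
        exact h4
    exact fun a ha => (hπ a).1 (χ.map_eq_zero_of_mem_ideal R hχ π (fun x => rfl) ha)
  have hker : ∀ a, Ideal.Quotient.mkₐ F (χ.ideal R).asIdeal a = 0 ↔
      a ∈ TwoSidedIdeal.span (Set.range w) := fun a =>
    (Ideal.Quotient.eq_zero_iff_mem.trans TwoSidedIdeal.mem_asIdeal).trans
      ⟨hIJ a, fun ha => hJI ha⟩
  refine exists_basis_quotient (wt := distWeight Dist) B hB
    (envι_comm_mem_lowerWeight b hd Dist) (envι_sq_mem_lowerWeight b hd Dist h2) w
    (exponentBound ε d p Dist) (fun x => ?_) (fun x hx => ?_) hw0 hlead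
    (fun x y => ⟨_, hcomm x y⟩) (fun x y => ⟨_, ε.val_ne_zero _ _, (hwc x).2 _ _ (hwc y).1⟩)
    (Ideal.Quotient.mkₐ F (χ.ideal R).asIdeal) (Ideal.Quotient.mkₐ_surjective F _) hker
  · unfold exponentBound
    split_ifs with h1 h4
    · obtain ⟨⟨⟨α, hα⟩, hq⟩, hx⟩ := h4
      have h5 : α = d x := eq_of_mem_deg (hx ▸ (rep ⟨⟨α, hα⟩, hq⟩).ξ.2) (hd x) (b.ne_zero x)
      subst h5
      obtain ⟨q, hq⟩ := hq
      exact Nat.mul_pos hp.pos (χ.addOrderOf_pos hq)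
    · exact hp.pos
    · norm_num
  · have : ε.val (d x) (d x) ≠ 1 := fun h => hneg (h.symm.trans hx)
    simp [exponentBound, this]

end Relators

end LieColorAlgebra

/-! ### Odd and even letters in a lexicographic sum -/

theorem content_map {X Y : Type*} [LinearOrder X] [LinearOrder Y] (g : X → Y) (l : List X) :
    content (l.map g) = Finsupp.mapDomain g (content l) := by
  induction l with
  | nil => ext; simp [content]
  | cons x l ih =>
    rw [List.map_cons, content_cons, content_cons, ih, Finsupp.mapDomain_add,
      Finsupp.mapDomain_single]

section SumLex

variable {M I A : Type*} [LinearOrder M] [LinearOrder I] [Ring A]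

/-- Exponents on a lexicographic sum are pairs of exponents. -/
def sumLexExponent : (M →₀ ℕ) × (I →₀ ℕ) ≃ (Lex (M ⊕ I) →₀ ℕ) :=
  Finsupp.sumFinsuppEquivProdFinsupp.symm.trans (Finsupp.equivCongrLeft toLex)

omit [LinearOrder M] [LinearOrder I] in
@[simp] theorem sumLexExponent_inl (dn : (M →₀ ℕ) × (I →₀ ℕ)) (j : M) :
    sumLexExponent dn (toLex (Sum.inl j)) = dn.1 j := by
  simp [sumLexExponent, Finsupp.equivMapDomain_apply]

omit [LinearOrder M] [LinearOrder I] in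
@[simp] theorem sumLexExponent_inr (dn : (M →₀ ℕ) × (I →₀ ℕ)) (i : I) :
    sumLexExponent dn (toLex (Sum.inr i)) = dn.2 i := by
  simp [sumLexExponent, Finsupp.equivMapDomain_apply]

/-- The concatenation is increasing, as every letter of `M` precedes every letter of `I`, and a
sorted word is determined by its content. -/
theorem sortedWord_sumLexExponent (dn : (M →₀ ℕ) × (I →₀ ℕ)) :
    sortedWord (sumLexExponent dn) = (sortedWord dn.1).map (fun j => toLex (Sum.inl j))
      ++ (sortedWord dn.2).map (fun i => toLex (Sum.inr i)) := by
  have hinl : Function.Injective fun j : M => (toLex (Sum.inl j) : Lex (M ⊕ I)) :=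
    toLex.injective.comp Sum.inl_injective
  have hinr : Function.Injective fun i : I => (toLex (Sum.inr i) : Lex (M ⊕ I)) :=
    toLex.injective.comp Sum.inr_injective
  have hc : content ((sortedWord dn.1).map (fun j => (toLex (Sum.inl j) : Lex (M ⊕ I)))
      ++ (sortedWord dn.2).map (fun i => toLex (Sum.inr i))) = sumLexExponent dn := by
    rw [content_append, content_map, content_map, content_sortedWord, content_sortedWord]
    ext x
    obtain ⟨x, rfl⟩ := toLex.surjective x
    rcases x with j | i
    · rw [Finsupp.add_apply, sumLexExponent_inl, Finsupp.mapDomain_apply hinl,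
        Finsupp.mapDomain_of_notMem_range _ _ (by rintro ⟨i, hi⟩; cases toLex.injective hi), add_zero]
    · rw [Finsupp.add_apply, sumLexExponent_inr, Finsupp.mapDomain_apply hinr,
        Finsupp.mapDomain_of_notMem_range _ _ (by rintro ⟨i, hi⟩; cases toLex.injective hi), zero_add]
  rw [← hc]
  refine sortedWord_content ?_
  rw [List.pairwise_append]
  refine ⟨?_, ?_, ?_⟩
  · rw [List.pairwise_map]
    exact (pairwise_sortedWord _).imp fun h => Sum.Lex.inl_le_inl_iff.2 h
  · rw [List.pairwise_map]
    exact (pairwise_sortedWord _).imp fun h => Sum.Lex.inr_le_inr_iff.2 h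
  · intro a ha c hc
    obtain ⟨j, -, rfl⟩ := List.mem_map.1 ha
    obtain ⟨i, -, rfl⟩ := List.mem_map.1 hc
    exact (Sum.Lex.inl_lt_inr j i).le

theorem orderedProd_sumLexExponent (z : Lex (M ⊕ I) → A) (dn : (M →₀ ℕ) × (I →₀ ℕ)) :
    orderedProd z (sumLexExponent dn) = orderedProd (fun j => z (toLex (Sum.inl j))) dn.1
      * orderedProd (fun i => z (toLex (Sum.inr i))) dn.2 := by
  simp only [orderedProd_eq_wordProd, sortedWord_sumLexExponent, wordProd, List.map_append,
    List.map_map, List.prod_append]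
  rfl

end SumLex

/-! ### The decomposition into odd and even parts, and the theorem -/

namespace LieColorAlgebra

variable {F Γ : Type*} [Field F] [AddCommGroup Γ] [DecidableEq Γ] {ε : Bicharacter F Γ}
  {L : Type*} [AddCommGroup L] [Module F L] (G : LieColorAlgebra ε L)

theorem isCompl_oddPart_evenPart (hneg : (1 : F) ≠ -1) : IsCompl G.oddPart G.evenPart := by
  have ho : G.oddPart = ⨆ γ ∈ {γ : Γ | ε.val γ γ = -1}, G.deg γ := iSup_subtype
  have he : G.evenPart = ⨆ γ ∈ {γ : Γ | ε.val γ γ = 1}, G.deg γ := iSup_subtype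
  rw [ho, he]
  constructor
  · refine G.isInternal.submodule_iSupIndep.disjoint_biSup_biSup ?_
    rw [Set.disjoint_left]
    intro γ h1 h2
    exact hneg (h2.symm.trans h1)
  · rw [codisjoint_iff, eq_top_iff, ← G.isInternal.submodule_iSup_eq_top]
    refine iSup_le fun γ => ?_
    rcases ε.val_self γ with h | h
    · exact le_sup_of_le_right (le_biSup G.deg h)
    · exact le_sup_of_le_left (le_biSup G.deg h)

theorem val_self_of_mem_evenPart (hneg : (1 : F) ≠ -1) {x : L} (hx : x ∈ G.evenPart) (h0 : x ≠ 0)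
    {γ : Γ} (hγ : x ∈ G.deg γ) : ε.val γ γ = 1 := by
  refine (ε.val_self γ).resolve_right fun h => h0 ?_
  have h1 : x ∈ G.oddPart := Submodule.mem_iSup_of_mem (⟨γ, h⟩ : ε.Odd) hγ
  exact Submodule.disjoint_def.1 (G.isCompl_oddPart_evenPart hneg).disjoint x h1 hx

theorem val_self_of_mem_oddPart (hneg : (1 : F) ≠ -1) {x : L} (hx : x ∈ G.oddPart) (h0 : x ≠ 0)
    {γ : Γ} (hγ : x ∈ G.deg γ) : ε.val γ γ = -1 := by
  refine (ε.val_self γ).resolve_left fun h => h0 ?_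
  have h1 : x ∈ G.evenPart := Submodule.mem_iSup_of_mem (⟨γ, h⟩ : ε.Even) hγ
  exact Submodule.disjoint_def.1 (G.isCompl_oddPart_evenPart hneg).disjoint x hx h1

end LieColorAlgebra

end ColorLie

end

theorem theorem2p13
    {F : Type*} [Field F] [IsAlgClosed F] (p : ℕ) [CharP F p] (hprime : p.Prime) (hp : 3 < p)
    {Γ : Type*} [AddCommGroup Γ] [DecidableEq Γ] (ε : ColorLie.Bicharacter F Γ)
    {L : Type*} [AddCommGroup L] [Module F L] (G : ColorLie.LieColorAlgebra ε L) (R : G.Restricted p)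
    (χ : G.PCharacter p)
    {I : Type*} [LinearOrder I] (e : Module.Basis I F G.evenPart)
    (he : ∀ i, G.IsHomogeneous (e i : L))
    {M : Type*} [LinearOrder M] (f : Module.Basis M F G.oddPart)
    (hf : ∀ j, G.IsHomogeneous (f j : L))
    (rep : (α : χ.ClassDegree) → G.DistPair α.1.1)
    (hrep : ∀ α : χ.ClassDegree, χ.toFun α.1 = Sum.inr ((rep α).mk' p))
    (hcontain : ∀ α : χ.ClassDegree, ∃ i, (e i : L) = (rep α).ξ) :
    ColorLie.LieColorAlgebra.PCharacter.IsReducedEnveloping.{w} χ R (G.inducedGrading (χ.σ R)) (χ.σ R) ∧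
    ∃ B : Module.Basis
        {dn : (M →₀ ℕ) × (I →₀ ℕ) //
          (∀ j, dn.1 j = 0 ∨ dn.1 j = 1) ∧
          (∀ i, (¬ ∃ α : χ.ClassDegree, (e i : L) = (rep α).ξ) → dn.2 i < p) ∧
          (∀ i, ∀ α : χ.ClassDegree, (e i : L) = (rep α).ξ →
            dn.2 i < p * addOrderOf (p • α.1.1))}
        F (χ.Reduced R),
      ∀ dn, B dn =
        ColorLie.orderedProd (fun j => χ.σ R (f j)) dn.1.1 * ColorLie.orderedProd (fun i => χ.σ R (e i)) dn.1.2 := by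
  have hneg : (1 : F) ≠ -1 := by
    have h2 : ((2 : ℕ) : F) ≠ 0 := by
      rw [Ne, CharP.cast_eq_zero_iff F p]
      exact Nat.not_dvd_of_pos_of_lt (by omega) (by omega)
    push_cast at h2
    exact fun h => h2 (by linear_combination h)
  refine ⟨χ.isReducedEnveloping R hprime, ?_⟩
  have hc := G.isCompl_oddPart_evenPart hneg
  -- The odd letters come first in the order, so that ordered monomials take the form `σ(f)^δ
  -- σ(e)^n`.
  let b : Module.Basis (Lex (M ⊕ I)) F L :=
    ((f.prod e).map (Submodule.prodEquivOfIsCompl _ _ hc)).reindex toLex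
  have hbl : ∀ j, b (toLex (Sum.inl j)) = f j := fun j => by
    simp [b, Module.Basis.reindex_apply]
  have hbr : ∀ i, b (toLex (Sum.inr i)) = e i := fun i => by
    simp [b, Module.Basis.reindex_apply]
  choose df hdf using hf
  choose de hde using he
  let d : Lex (M ⊕ I) → Γ := fun x => Sum.elim df de (ofLex x)
  have hd : ∀ x, b x ∈ G.deg (d x) := by
    intro x
    obtain ⟨x, rfl⟩ := toLex.surjective x
    rcases x with j | i
    · rw [hbl]
      exact hdf j
    · rw [hbr]
      exact hde i
  have hfne : ∀ j, (f j : L) ≠ 0 := fun j h => f.ne_zero j (Subtype.ext h)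
  have hene : ∀ i, (e i : L) ≠ 0 := fun i h => e.ne_zero i (Subtype.ext h)
  have hodd : ∀ j, ε.val (d (toLex (Sum.inl j))) (d (toLex (Sum.inl j))) = -1 := fun j =>
    G.val_self_of_mem_oddPart hneg (f j).2 (hfne j) (hdf j)
  have heven : ∀ i, ε.val (d (toLex (Sum.inr i))) (d (toLex (Sum.inr i))) = 1 := fun i =>
    G.val_self_of_mem_evenPart hneg (e i).2 (hene i) (hde i)
  have hdist : ∀ i, ColorLie.LieColorAlgebra.IsDistinguished b rep (toLex (Sum.inr i)) ↔
      ∃ α : χ.ClassDegree, (e i : L) = (rep α).ξ := fun i => by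
    simp only [ColorLie.LieColorAlgebra.IsDistinguished, hbr]
  obtain ⟨B, hB⟩ := ColorLie.LieColorAlgebra.exists_reduced_basis (R := R) b hd hprime hp rep hrep
    (fun α => by
      obtain ⟨i, hi⟩ := hcontain α
      exact ⟨toLex (Sum.inr i), by rw [hbr, hi]⟩)
  have hboundl : ∀ j, ColorLie.LieColorAlgebra.exponentBound ε d p
      (ColorLie.LieColorAlgebra.IsDistinguished b rep) (toLex (Sum.inl j)) = 2 := fun j => by
    have h : ε.val (d (toLex (Sum.inl j))) (d (toLex (Sum.inl j))) ≠ 1 := fun h =>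
      hneg (h.symm.trans (hodd j))
    simp [ColorLie.LieColorAlgebra.exponentBound, h]
  have hboundr : ∀ i, (¬ ∃ α : χ.ClassDegree, (e i : L) = (rep α).ξ) →
      ColorLie.LieColorAlgebra.exponentBound ε d p
        (ColorLie.LieColorAlgebra.IsDistinguished b rep) (toLex (Sum.inr i)) = p := fun i hi => by
    rw [ColorLie.LieColorAlgebra.exponentBound, if_pos (heven i), if_neg (mt (hdist i).1 hi)]
  have hboundx : ∀ i (α : χ.ClassDegree), (e i : L) = (rep α).ξ →
      ColorLie.LieColorAlgebra.exponentBound ε d p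
        (ColorLie.LieColorAlgebra.IsDistinguished b rep) (toLex (Sum.inr i))
        = p * addOrderOf (p • α.1.1) := fun i α hi => by
    -- The degree chosen for `e i` must be the degree of `ξ`, since `e i ≠ 0`; the order of `pα` in
    -- the bound is therefore the intended one.
    have h : d (toLex (Sum.inr i)) = α.1.1 :=
      ColorLie.LieColorAlgebra.eq_of_mem_deg (hde i) (hi ▸ (rep α).ξ.2) (hene i)
    rw [ColorLie.LieColorAlgebra.exponentBound, if_pos (heven i), if_pos ((hdist i).2 ⟨α, hi⟩), h]
  refine ⟨B.reindex (ColorLie.sumLexExponent.subtypeEquiv fun dn => ?_).symm, fun dn => ?_⟩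
  · constructor
    · rintro ⟨h1, h2, h3⟩ x
      obtain ⟨x, rfl⟩ := toLex.surjective x
      rcases x with j | i
      · rw [hboundl, ColorLie.sumLexExponent_inl]
        rcases h1 j with h | h <;> omega
      · rw [ColorLie.sumLexExponent_inr]
        by_cases hi : ∃ α : χ.ClassDegree, (e i : L) = (rep α).ξ
        · obtain ⟨α, hα⟩ := hi
          rw [hboundx i α hα]
          exact h3 i α hα
        · rw [hboundr i hi]
          exact h2 i hi
    · intro h
      refine ⟨fun j => ?_, fun i hi => ?_, fun i α hα => ?_⟩
      · have := h (toLex (Sum.inl j))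
        rw [hboundl, ColorLie.sumLexExponent_inl] at this
        omega
      · have := h (toLex (Sum.inr i))
        rwa [hboundr i hi, ColorLie.sumLexExponent_inr] at this
      · have := h (toLex (Sum.inr i))
        rwa [hboundx i α hα, ColorLie.sumLexExponent_inr] at this
  · rw [Module.Basis.reindex_apply, hB]
    change ColorLie.orderedProd _ (ColorLie.sumLexExponent dn.1) = _
    rw [ColorLie.orderedProd_sumLexExponent]
    simp only [hbl, hbr]
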